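/- Let $(W,S)$ be a Coxeter system with length function $\ell$. Let $\mathfrak h$ be a finite-dimensional real vector space with linearly independent families $\{\alpha_s\}_{s\in S}\subset\mathfrak h^*$ and $\{\alpha_s^\vee\}_{s\in S}\subset\mathfrak h$ such that $\langle\alpha_s,\alpha_t^\vee\rangle=-2\cos(\pi/m_{st})$, of minimal dimension among all such data. Let $W$ act on $\mathfrak h$ by $s(v)=v-\langle\alpha_s,v\rangle\alpha_s^\vee$. Let $R=S(\mathfrak h^*)$, graded with $\deg\mathfrak h^*=2$, let $\Phi=\bigcup_{w\in W}w\{\alpha_s\}$ be the set of roots, let $Q=R[1/\Phi]$, and let $\partial_s(f)=(f-s(f))/\alpha_s$. *Equivariant multiplicities.* Let $Q_W=\bigoplus_{w\in W}Q\,\delta_w$ be the smash product, with $(f\delta_x)(g\delta_y)=f\,x(g)\,\delta_{xy}$, and let $D_s=\frac1{\alpha_s}(\delta_{\mathrm{id}}-\delta_s)$. For a reduced expression $y=st\cdots u$ put $D_y=D_sD_t\cdots D_u$. The $e_{x,y}\in Q$ are defined by $D_y=\sum_x e_{x,y}\,\delta_x$. *Soergel bimodules.* For a word $\underline w=s_1\cdots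 s_m$ let $B(\underline w)=B(s_1)\otimes_R\cdots\otimes_R B(s_m)$ with $B(s)=R\otimes_{R^s}R[1]$, a graded $R$-bimodule and a ring. Its intersection form is $\langle b,b'\rangle=\mathrm{Tr}(bb')$, where $\mathrm{Tr}(f_0\otimes\cdots\otimes f_m)=f_0\,\partial_{s_1}(f_1\,\partial_{s_2}(f_2\cdots\partial_{s_m}(f_m)))$; equivalently $\mathrm{Tr}$ takes the coefficient of $c_{s_1}\cdots c_{s_m}$ in the left $R$-basis of products of the elements $c_{\mathrm{id}}=1\otimes1$ and $c_s=\frac12(\alpha_s\otimes1+1\otimes\alpha_s)$. For $y\in W$ with reduced expression $\underline y$, the bimodule $B(y)$ is the indecomposable graded summand of $B(\underline y)$ that is not isomorphic to a shift of a summand of $B(\underline w)$ for any word $\underline w$ shorter than $\underline y$. Fix a realisation of $B(y)$ as a graded bimodule summand of $B(\underline y)$ for some reduced expression $\underline y$ of $y$. The intersection form $\langle-,-\rangle_{B(y)}$ is the restriction of that of $B(\underline y)$. *Local intersection forms.* For $x\in W$ let $B(y)_x^!$ (resp. $B(y)_x$) be the largest submodule (resp. quotient) of $B(y)$ on which $b\cdot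 r=x(r)\cdot b$ for all $r\in R$, and let $i_x:B(y)_x^!\hookrightarrow B(y)\twoheadrightarrow B(y)_x$ be the canonical map. The local intersection form $\langle-,-\rangle^x_{B(y)}$ is the $R$-bilinear $Q$-valued form on $B(y)_x$ such that $\langle i_x(m),i_x(m')\rangle^x_{B(y)}=\langle m,m'\rangle_{B(y)}$ for all $m,m'\in B(y)_x^!$. **Theorem.** Let $x,y\in W$, and let $c_{\mathrm{bot}}$ be a non-zero element of $B(y)^{-\ell(y)}$. Then there is exactly one local intersection form on $B(y)_x$. The stalk $B(y)_x$ vanishes in degrees below $-\ell(y)$, and $B(y)_x^{-\ell(y)}$ is spanned over $\mathbb R$ by the image of $c_{\mathrm{bot}}$. If $c_{x,y}$ is any vector that spans $B(y)_x^{-\ell(y)}$ over $\mathbb R$ (in particular, if it is the image of $c_{\mathrm{bot}}$), then $$\langle c_{x,y},c_{x,y}\rangle^x_{B(y)}=\gamma\,e_{x,y}\qquad\text{for some }\gamma\in\mathbb R_{>0}.$$ -/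

import Mathlib

open Module

namespace Soergel

/-- A realisation over `ℝ` of the Coxeter group with Coxeter matrix `M`: simple roots in `V*` and
simple coroots in `V`, both linearly independent, with `⟨α_s, α_t^∨⟩ = -2 cos (π / m_st)`.
Mathlib encodes `m_st = ∞` as `M s t = 0`; then `π / 0 = 0` and the pairing is `-2`, as it should. -/
structure Realisation {I : Type*} (M : CoxeterMatrix I) (V : Type*)
    [AddCommGroup V] [Module ℝ V] where
  root : I → Dual ℝ V
  coroot : I → V
  linearIndependent_root : LinearIndependent ℝ root
  linearIndependent_coroot : LinearIndependent ℝ coroot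
  root_coroot : ∀ s t, root s (coroot t) = -2 * Real.cos (Real.pi / M s t)

namespace Realisation

variable {I W V : Type*} [Group W] {M : CoxeterMatrix I}
  [AddCommGroup V] [Module ℝ V]

/-- The underlying space has the least dimension among all realisations of `M`. -/
def IsMinimal (_H : Realisation M V) : Prop :=
  ∀ n : ℕ, Nonempty (Realisation M (Fin n → ℝ)) → finrank ℝ V ≤ n

theorem root_coroot_self (H : Realisation M V) (s : I) : H.root s (H.coroot s) = 2 := by
  rw [H.root_coroot, M.diagonal]; simp

/-- The reflection `v ↦ v - ⟨α_s, v⟩ α_s^∨` of `V`. -/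
def simpleReflection (H : Realisation M V) (s : I) : V ≃ₗ[ℝ] V :=
  Module.reflection (H.root_coroot_self s)

theorem simpleReflection_apply (H : Realisation M V) (s : I) (v : V) :
    H.simpleReflection s v = v - H.root s v • H.coroot s :=
  Module.reflection_apply v (H.root_coroot_self s)

open Polynomial.Chebyshev in
theorem chebyshev_aux (m : ℕ) (hm : 3 ≤ m) (t : ℝ) (ht : t = 2 * Real.cos (2 * (Real.pi / m))) :
    (S ℝ (((m : ℤ) - 2) / 2)).eval t *
        ((S ℝ (((m : ℤ) - 1) / 2)).eval t + (S ℝ (((m : ℤ) - 3) / 2)).eval t) = 0 ∧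
      (S ℝ (((m : ℤ) - 1) / 2)).eval t *
        ((S ℝ ((m : ℤ) / 2)).eval t + (S ℝ (((m : ℤ) - 2) / 2)).eval t) = 0 := by
  have hm0 : (0 : ℝ) < m := by positivity
  have hm3 : (3 : ℝ) ≤ m := by exact_mod_cast hm
  set θ : ℝ := 2 * (Real.pi / m) with hθ
  have hmθ : m * θ = 2 * Real.pi := by rw [hθ]; field_simp
  have hsin : Real.sin θ ≠ 0 := by
    apply ne_of_gt
    apply Real.sin_pos_of_pos_of_lt_pi
    · positivity
    · have := Real.pi_pos
      by_contra h
      push Not at h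
      nlinarith
  have key (n : ℤ) : (S ℝ n).eval t = Real.sin ((n + 1) * θ) / Real.sin θ := by
    rw [eq_div_iff hsin, ht]; exact S_two_mul_real_cos θ n
  obtain ⟨k, rfl | rfl⟩ := Nat.even_or_odd' m
  · have h1 : (((2 * k : ℕ) : ℤ) - 2) / 2 = k - 1 := by omega
    have h2 : (((2 * k : ℕ) : ℤ) - 1) / 2 = k - 1 := by omega
    have hz : (S ℝ ((k : ℤ) - 1)).eval t = 0 := by
      rw [key]
      have : ((((k : ℤ) - 1 : ℤ) : ℝ) + 1) * θ = Real.pi := by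
        push_cast at hmθ ⊢; linarith
      rw [this]; simp
    rw [h1, h2, hz]; simp
  · have h1 : (((2 * k + 1 : ℕ) : ℤ) - 2) / 2 = k - 1 := by omega
    have h2 : (((2 * k + 1 : ℕ) : ℤ) - 1) / 2 = k := by omega
    have h3 : (((2 * k + 1 : ℕ) : ℤ) - 3) / 2 = k - 1 := by omega
    have h4 : (((2 * k + 1 : ℕ) : ℤ)) / 2 = k := by omega
    have hz : (S ℝ (k : ℤ)).eval t + (S ℝ ((k : ℤ) - 1)).eval t = 0 := by
      rw [key, key, ← add_div]
      have e1 : (((k : ℤ) : ℝ) + 1) * θ = 2 * Real.pi - k * θ := by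
        push_cast at hmθ ⊢; linarith
      have e2 : ((((k : ℤ) - 1 : ℤ) : ℝ) + 1) * θ = k * θ := by
        push_cast; ring
      rw [e1, e2, Real.sin_two_pi_sub]; simp
    rw [h1, h2, h3, h4, hz]; simp

/-- The simple reflections satisfy the Coxeter relations. -/
theorem isLiftable (H : Realisation M V) : M.IsLiftable H.simpleReflection := by
  intro i j
  by_cases hij : i = j
  · subst hij
    rw [M.diagonal, pow_one]
    ext v
    exact Module.involutive_reflection (H.root_coroot_self i) v
  · have hsym : H.root j (H.coroot i) = H.root i (H.coroot j) := by
      rw [H.root_coroot, H.root_coroot, M.symmetric]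
    have hne1 : M i j ≠ 1 := M.off_diagonal i j hij
    rcases Nat.lt_or_ge (M i j) 3 with h | h
    · have h02 : M i j = 0 ∨ M i j = 2 := by omega
      rcases h02 with h0 | h2
      · rw [h0, pow_zero]
      · have hc : H.root i (H.coroot j) = 0 := by
          rw [H.root_coroot, h2]; norm_num
        have hc' : H.root j (H.coroot i) = 0 := by rw [hsym, hc]
        rw [h2, pow_two]
        ext v
        simp only [LinearEquiv.mul_apply, simpleReflection_apply, map_sub, map_smul, hc, hc',
          root_coroot_self, LinearEquiv.coe_one, id_eq, sub_zero, zero_smul]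
        module
    · ext v
      have ht : 2 * Real.cos (2 * (Real.pi / (M i j : ℕ))) =
          H.root i (H.coroot j) * H.root j (H.coroot i) - 2 := by
        rw [hsym, H.root_coroot, Real.cos_two_mul]; ring
      obtain ⟨e1, e2⟩ := chebyshev_aux (M i j) h _ rfl
      have := Module.reflection_mul_reflection_pow_apply (H.root_coroot_self i)
        (H.root_coroot_self j) (M i j) v _ ht
      rw [e1, e2] at this
      simpa [simpleReflection] using this

/-- The action of `W` on `V`, given by `s ↦ (v ↦ v - ⟨α_s, v⟩ α_s^∨)`. -/
def rep (cs : CoxeterSystem M W) (H : Realisation M V) : W →* (V ≃ₗ[ℝ] V) :=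
  cs.lift ⟨H.simpleReflection, H.isLiftable⟩

theorem rep_simple (cs : CoxeterSystem M W) (H : Realisation M V) (s : I) :
    H.rep cs (cs.simple s) = H.simpleReflection s :=
  cs.lift_apply_simple H.isLiftable s


/-- The contragredient action of `W` on `V*`: `(w f)(v) = f (w⁻¹ v)`. -/
def dualRep (cs : CoxeterSystem M W) (H : Realisation M V) :
    W →* (Dual ℝ V →ₗ[ℝ] Dual ℝ V) where
  toFun w := (H.rep cs w⁻¹).toLinearMap.dualMap
  map_one' := by
    ext f v
    simp
  map_mul' w w' := by
    ext f v
    simp [LinearMap.dualMap_apply, mul_inv_rev]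

theorem dualRep_apply (cs : CoxeterSystem M W) (H : Realisation M V) (w : W) (f : Dual ℝ V)
    (v : V) : H.dualRep cs w f v = f (H.rep cs w⁻¹ v) := rfl

theorem dualRep_simple (cs : CoxeterSystem M W) (H : Realisation M V) (s : I) (f : Dual ℝ V) :
    H.dualRep cs (cs.simple s) f = f - f (H.coroot s) • H.root s := by
  ext v
  rw [dualRep_apply, cs.inv_simple, rep_simple, simpleReflection_apply]
  simp [mul_comm]

/-- The set of roots `Φ = ⋃ w {α_s} ⊆ V*`. -/
def roots (cs : CoxeterSystem M W) (H : Realisation M V) : Set (Dual ℝ V) :=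
  {β | ∃ (w : W) (s : I), β = H.dualRep cs w (H.root s)}

end Realisation

/-- The ring `R = S(V*)` of regular functions on `V`. -/
abbrev PolyRing (V : Type*) [AddCommGroup V] [Module ℝ V] : Type _ :=
  SymmetricAlgebra ℝ (Dual ℝ V)

section
variable {I W V : Type*} [Group W] {M : CoxeterMatrix I}
  [AddCommGroup V] [Module ℝ V]

/-- The degree `d` part of `R = S(V*)`, where elements of `V*` have degree `2`: the span of the
products of `n` linear forms with `2 n = d`. -/
def polyGr (V : Type*) [AddCommGroup V] [Module ℝ V] (d : ℤ) : Submodule ℝ (PolyRing V) :=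
  Submodule.span ℝ {f | ∃ l : List (Dual ℝ V), 2 * (l.length : ℤ) = d ∧
    f = (l.map (SymmetricAlgebra.ι ℝ (Dual ℝ V))).prod}

/-- The action of `W` on `R` by algebra automorphisms, extending the action on `V*`. -/
def polyAct (cs : CoxeterSystem M W) (H : Realisation M V) :
    W →* (PolyRing V →ₐ[ℝ] PolyRing V) where
  toFun w := SymmetricAlgebra.lift (SymmetricAlgebra.ι ℝ (Dual ℝ V) ∘ₗ H.dualRep cs w)
  map_one' := by
    ext f
    simp
  map_mul' w w' := by
    ext f
    simp

@[simp]
theorem polyAct_ι (cs : CoxeterSystem M W) (H : Realisation M V) (w : W) (f : Dual ℝ V) :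
    polyAct cs H w (SymmetricAlgebra.ι ℝ _ f) = SymmetricAlgebra.ι ℝ _ (H.dualRep cs w f) := by
  simp [polyAct]

/-- The multiplicative subset of `R` generated by the roots. -/
def rootMonoid (cs : CoxeterSystem M W) (H : Realisation M V) : Submonoid (PolyRing V) :=
  Submonoid.closure (SymmetricAlgebra.ι ℝ (Dual ℝ V) '' H.roots cs)

theorem rootMonoid_le_comap (cs : CoxeterSystem M W) (H : Realisation M V) (w : W) :
    rootMonoid cs H ≤ (rootMonoid cs H).comap (polyAct cs H w).toRingHom := by
  rw [rootMonoid, Submonoid.closure_le]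
  rintro _ ⟨_, ⟨u, s, rfl⟩, rfl⟩
  refine Submonoid.subset_closure ⟨_, ⟨w * u, s, rfl⟩, ?_⟩
  simp

/-- The localisation `Q = R[1/Φ]` of `R` at all roots. -/
def RootLoc (cs : CoxeterSystem M W) (H : Realisation M V) : Type _ :=
  Localization (rootMonoid cs H)

noncomputable instance (cs : CoxeterSystem M W) (H : Realisation M V) :
    CommRing (RootLoc cs H) :=
  inferInstanceAs (CommRing (Localization (rootMonoid cs H)))

noncomputable instance (cs : CoxeterSystem M W) (H : Realisation M V) :
    Algebra (PolyRing V) (RootLoc cs H) :=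
  inferInstanceAs (Algebra (PolyRing V) (Localization (rootMonoid cs H)))

instance (cs : CoxeterSystem M W) (H : Realisation M V) :
    IsLocalization (rootMonoid cs H) (RootLoc cs H) :=
  inferInstanceAs (IsLocalization (rootMonoid cs H) (Localization (rootMonoid cs H)))

noncomputable instance (cs : CoxeterSystem M W) (H : Realisation M V) :
    Algebra ℝ (RootLoc cs H) :=
  Algebra.compHom _ (algebraMap ℝ (PolyRing V))

/-- The extension to `Q` of the action of `w` on `R`. -/
noncomputable def locAct (cs : CoxeterSystem M W) (H : Realisation M V) (w : W) :
    RootLoc cs H →+* RootLoc cs H :=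
  IsLocalization.map (RootLoc cs H) (polyAct cs H w).toRingHom (rootMonoid_le_comap cs H w)

theorem locAct_algebraMap (cs : CoxeterSystem M W) (H : Realisation M V) (w : W)
    (f : PolyRing V) :
    locAct cs H w (algebraMap _ _ f) = algebraMap _ _ (polyAct cs H w f) :=
  IsLocalization.map_eq _ f

theorem locAct_one (cs : CoxeterSystem M W) (H : Realisation M V) :
    locAct cs H 1 = RingHom.id _ := by
  apply IsLocalization.ringHom_ext (rootMonoid cs H)
  ext f
  simp [locAct_algebraMap]

theorem locAct_mul (cs : CoxeterSystem M W) (H : Realisation M V) (w w' : W) :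
    locAct cs H (w * w') = (locAct cs H w).comp (locAct cs H w') := by
  apply IsLocalization.ringHom_ext (rootMonoid cs H)
  ext f
  simp [locAct_algebraMap]

noncomputable instance (cs : CoxeterSystem M W) (H : Realisation M V) :
    MulSemiringAction W (RootLoc cs H) where
  smul w q := locAct cs H w q
  one_smul q := congrArg (fun g : RootLoc cs H →+* RootLoc cs H => g q) (locAct_one cs H)
  mul_smul w w' q :=
    congrArg (fun g : RootLoc cs H →+* RootLoc cs H => g q) (locAct_mul cs H w w')
  smul_zero w := map_zero (locAct cs H w)
  smul_add w := map_add (locAct cs H w)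
  smul_one w := map_one (locAct cs H w)
  smul_mul w := map_mul (locAct cs H w)

/-- The smash product `Q_W`: free left `Q`-module on the symbols `δ_w`, with multiplication
`(f δ_x) (g δ_y) = f x(g) δ_{xy}`. Here `f δ_x` is `SkewMonoidAlgebra.single x f`. -/
abbrev SmashProduct (cs : CoxeterSystem M W) (H : Realisation M V) : Type _ :=
  SkewMonoidAlgebra (RootLoc cs H) W

theorem root_mem_rootMonoid (cs : CoxeterSystem M W) (H : Realisation M V) (s : I) :
    SymmetricAlgebra.ι ℝ (Dual ℝ V) (H.root s) ∈ rootMonoid cs H :=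
  Submonoid.subset_closure ⟨_, ⟨1, s, by simp⟩, rfl⟩

/-- The element `1 / α_s` of `Q`. -/
noncomputable def invRoot (cs : CoxeterSystem M W) (H : Realisation M V) (s : I) :
    RootLoc cs H :=
  IsLocalization.mk' (RootLoc cs H) 1 ⟨_, root_mem_rootMonoid cs H s⟩

/-- The element `D_s = (1 / α_s) (δ_id - δ_s)` of `Q_W`. -/
noncomputable def nilD (cs : CoxeterSystem M W) (H : Realisation M V) (s : I) :
    SmashProduct cs H :=
  SkewMonoidAlgebra.single 1 (invRoot cs H s) *
    (SkewMonoidAlgebra.single 1 1 - SkewMonoidAlgebra.single (cs.simple s) 1)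

/-- The product `D_s D_t ⋯ D_u` along a word `η = s t ⋯ u`. For a reduced word of `y` this is `D_y`. -/
noncomputable def nilDWord (cs : CoxeterSystem M W) (H : Realisation M V) (η : List I) :
    SmashProduct cs H :=
  (η.map (nilD cs H)).prod

/-- The coefficient of `δ_x` in the product of the `D_s` along `η`. For `η` a reduced word of `y`
this is the equivariant multiplicity `e_{x,y}`. -/
noncomputable def equivMult (cs : CoxeterSystem M W) (H : Realisation M V) (x : W) (η : List I) :
    RootLoc cs H :=
  (nilDWord cs H η).coeff x

/-! ### Divided differences -/

theorem exists_demazure (cs : CoxeterSystem M W) (H : Realisation M V) (s : I) (f : PolyRing V) :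
    ∃ g : PolyRing V,
      SymmetricAlgebra.ι ℝ _ (H.root s) * g = f - polyAct cs H (cs.simple s) f := by
  induction f using SymmetricAlgebra.induction with
  | algebraMap r => exact ⟨0, by simp⟩
  | ι f =>
    refine ⟨algebraMap ℝ _ (f (H.coroot s)), ?_⟩
    rw [polyAct_ι, H.dualRep_simple, map_sub, sub_sub_cancel, map_smul, mul_comm,
      Algebra.smul_def]
  | mul a b ha hb =>
    obtain ⟨a', ha⟩ := ha
    obtain ⟨b', hb⟩ := hb
    refine ⟨a' * b + polyAct cs H (cs.simple s) a * b', ?_⟩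
    rw [map_mul]
    linear_combination b * ha + polyAct cs H (cs.simple s) a * hb
  | add a b ha hb =>
    obtain ⟨a', ha⟩ := ha
    obtain ⟨b', hb⟩ := hb
    exact ⟨a' + b', by rw [mul_add, ha, hb, map_add]; ring⟩

theorem root_ne_zero (H : Realisation M V) (s : I) :
    SymmetricAlgebra.ι ℝ _ (H.root s) ≠ 0 := by
  intro h
  have := congrArg (SymmetricAlgebra.lift
    (LinearMap.toSpanSingleton ℝ ℝ 1 ∘ₗ (Dual.eval ℝ V (H.coroot s)))) h
  simp [H.root_coroot_self] at this

/-- The divided difference `∂_s f = (f - s f) / α_s`, an element of `R`. -/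
noncomputable def demazure (cs : CoxeterSystem M W) (H : Realisation M V) (s : I)
    (f : PolyRing V) : PolyRing V :=
  (exists_demazure cs H s f).choose

theorem root_mul_demazure (cs : CoxeterSystem M W) (H : Realisation M V) (s : I)
    (f : PolyRing V) :
    SymmetricAlgebra.ι ℝ _ (H.root s) * demazure cs H s f = f - polyAct cs H (cs.simple s) f :=
  (exists_demazure cs H s f).choose_spec

theorem demazure_eq (cs : CoxeterSystem M W) (H : Realisation M V) (s : I) {f g : PolyRing V}
    (h : SymmetricAlgebra.ι ℝ _ (H.root s) * g = f - polyAct cs H (cs.simple s) f) :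
    demazure cs H s f = g :=
  mul_left_cancel₀ (root_ne_zero H s) ((root_mul_demazure cs H s f).trans h.symm)

theorem demazure_add (cs : CoxeterSystem M W) (H : Realisation M V) (s : I) (f g : PolyRing V) :
    demazure cs H s (f + g) = demazure cs H s f + demazure cs H s g := by
  apply demazure_eq
  rw [mul_add, root_mul_demazure, root_mul_demazure, map_add]
  ring

theorem demazure_ι (cs : CoxeterSystem M W) (H : Realisation M V) (s : I) (f : Dual ℝ V) :
    demazure cs H s (SymmetricAlgebra.ι ℝ _ f) = algebraMap ℝ _ (f (H.coroot s)) := by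
  apply demazure_eq
  rw [polyAct_ι, H.dualRep_simple, map_sub, sub_sub_cancel, map_smul, mul_comm, Algebra.smul_def]

theorem demazure_mul (cs : CoxeterSystem M W) (H : Realisation M V) (s : I) (f g : PolyRing V) :
    demazure cs H s (f * g) =
      demazure cs H s f * g + polyAct cs H (cs.simple s) f * demazure cs H s g := by
  apply demazure_eq
  have h1 := root_mul_demazure cs H s f
  have h2 := root_mul_demazure cs H s g
  rw [map_mul]
  linear_combination g * h1 + polyAct cs H (cs.simple s) f * h2

theorem demazure_of_inv (cs : CoxeterSystem M W) (H : Realisation M V) (s : I) {f : PolyRing V}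
    (h : polyAct cs H (cs.simple s) f = f) : demazure cs H s f = 0 := by
  apply demazure_eq
  rw [h, mul_zero, sub_self]

/-- `∂_s` as an additive map. -/
noncomputable def demazureHom (cs : CoxeterSystem M W) (H : Realisation M V) (s : I) :
    PolyRing V →+ PolyRing V :=
  AddMonoidHom.mk' (demazure cs H s) (demazure_add cs H s)

/-- The ring of invariants `R^s`. -/
def invariants (cs : CoxeterSystem M W) (H : Realisation M V) (s : I) :
    Subalgebra ℝ (PolyRing V) :=
  AlgHom.equalizer (polyAct cs H (cs.simple s)) (AlgHom.id ℝ (PolyRing V))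

theorem polyGr_algebraMap (r : ℝ) : algebraMap ℝ (PolyRing V) r ∈ polyGr V 0 := by
  rw [Algebra.algebraMap_eq_smul_one]
  exact Submodule.smul_mem _ _ (Submodule.subset_span ⟨[], by simp, by simp⟩)

theorem polyGr_mul {i j : ℤ} {f g : PolyRing V} (hf : f ∈ polyGr V i) (hg : g ∈ polyGr V j) :
    f * g ∈ polyGr V (i + j) := by
  have := Submodule.mul_mem_mul hf hg
  rw [polyGr, polyGr, Submodule.span_mul_span] at this
  refine Submodule.span_mono ?_ this
  rintro _ ⟨_, ⟨l, hl, rfl⟩, _, ⟨l', hl', rfl⟩, rfl⟩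
  exact ⟨l ++ l', by rw [List.length_append]; push_cast; omega, by simp⟩

theorem polyGr_ι (f : Dual ℝ V) : SymmetricAlgebra.ι ℝ _ f ∈ polyGr V 2 :=
  Submodule.subset_span ⟨[f], by simp, by simp⟩

theorem polyGr_act (cs : CoxeterSystem M W) (H : Realisation M V) (w : W) {d : ℤ}
    {f : PolyRing V} (hf : f ∈ polyGr V d) : polyAct cs H w f ∈ polyGr V d := by
  induction hf using Submodule.span_induction with
  | mem f hf =>
    obtain ⟨l, hl, rfl⟩ := hf
    refine Submodule.subset_span ⟨l.map (H.dualRep cs w), by simpa using hl, ?_⟩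
    rw [map_list_prod, List.map_map, List.map_map]
    congr 1
    apply List.map_congr_left
    intro a _
    simp
  | zero => simp
  | add f g _ _ hf hg => rw [map_add]; exact add_mem hf hg
  | smul r f _ hf => rw [map_smul]; exact Submodule.smul_mem _ _ hf

theorem demazure_smul (cs : CoxeterSystem M W) (H : Realisation M V) (s : I) (r : ℝ)
    (f : PolyRing V) : demazure cs H s (r • f) = r • demazure cs H s f := by
  apply demazure_eq
  rw [mul_smul_comm, root_mul_demazure, map_smul, smul_sub]

theorem polyGr_demazure (cs : CoxeterSystem M W) (H : Realisation M V) (s : I) {d : ℤ}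
    {f : PolyRing V} (hf : f ∈ polyGr V d) : demazure cs H s f ∈ polyGr V (d - 2) := by
  induction hf using Submodule.span_induction with
  | mem f hf =>
    obtain ⟨l, hl, rfl⟩ := hf
    induction l generalizing d with
    | nil =>
      rw [List.map_nil, List.prod_nil, demazure_of_inv cs H s (map_one _)]
      exact zero_mem _
    | cons a l ih =>
      rw [List.map_cons, List.prod_cons, demazure_mul, demazure_ι, polyAct_ι]
      rw [List.length_cons] at hl
      push_cast at hl
      refine add_mem ?_ ?_
      · rw [← Algebra.smul_def]
        exact Submodule.smul_mem _ _ (Submodule.subset_span ⟨l, by omega, rfl⟩)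
      · have h := polyGr_mul (polyGr_ι (H.dualRep cs (cs.simple s) a)) (ih (d := d - 2) (by omega))
        have e : 2 + (d - 2 - 2) = d - 2 := by ring
        rwa [e] at h
  | zero => rw [demazure_of_inv cs H s (map_zero _)]; exact zero_mem _
  | add f g _ _ hf hg => rw [demazure_add]; exact add_mem hf hg
  | smul r f _ hf => rw [demazure_smul]; exact Submodule.smul_mem _ _ hf

/-! ### Internal gradings -/

/-- A criterion for a family of subgroups to be a grading (internal direct sum). -/
theorem isInternal_of {A : Type*} [AddCommGroup A] (gr : ℤ → AddSubgroup A)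
    (φ : A →+ (ℤ → A)) (hφ : ∀ d, ∀ a ∈ gr d, φ a = Pi.single d a)
    (hspan : ∀ a, a ∈ ⨆ d, gr d) : DirectSum.IsInternal gr := by
  have key : ∀ (x : DirectSum ℤ fun d => gr d) (d : ℤ),
      φ (DirectSum.coeAddMonoidHom gr x) d = x d := by
    intro x d
    induction x using DirectSum.induction_on with
    | zero => simp
    | of i a =>
      rw [DirectSum.coeAddMonoidHom_of, hφ i a a.2]
      by_cases h : i = d
      · subst h; simp
      · rw [Pi.single_eq_of_ne (Ne.symm h), DirectSum.of_eq_of_ne _ _ _ (Ne.symm h)]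
        rfl
    | add x y hx hy => simp [hx, hy]
  refine ⟨fun x y h => ?_, fun a => ?_⟩
  · apply DFinsupp.ext
    intro d
    apply Subtype.ext
    rw [← key x d, ← key y d, h]
  · refine AddSubgroup.iSup_induction gr (C := fun a => ∃ x, DirectSum.coeAddMonoidHom gr x = a)
      (hspan a) ?_ ?_ ?_
    · exact fun i a ha => ⟨DirectSum.of (fun d => gr d) i ⟨a, ha⟩, by simp⟩
    · exact ⟨0, by simp⟩
    · rintro _ _ ⟨x, rfl⟩ ⟨y, rfl⟩
      exact ⟨x + y, by simp⟩

theorem exists_components {A : Type*} [AddCommGroup A] {gr : ℤ → AddSubgroup A}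
    (h : DirectSum.IsInternal gr) :
    (∃ φ : A →+ (ℤ → A), ∀ d, ∀ a ∈ gr d, φ a = Pi.single d a) ∧ ∀ a, a ∈ ⨆ d, gr d := by
  let e := AddEquiv.ofBijective (DirectSum.coeAddMonoidHom gr) h
  have he : ∀ d (a : gr d), e.symm a = DirectSum.of (fun d => gr d) d a := by
    intro d a
    rw [AddEquiv.symm_apply_eq]
    exact (DirectSum.coeAddMonoidHom_of gr d a).symm
  refine ⟨⟨AddMonoidHom.mk' (fun a d => ((e.symm a) d : A)) ?_, ?_⟩, ?_⟩
  · intro a b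
    ext d
    simp
  · intro d a ha
    ext i
    rw [AddMonoidHom.mk'_apply, he d ⟨a, ha⟩]
    by_cases h : i = d
    · subst h; simp
    · rw [Pi.single_eq_of_ne h, DirectSum.of_eq_of_ne _ _ _ h]
      rfl
  · intro a
    obtain ⟨x, rfl⟩ := h.2 a
    induction x using DirectSum.induction_on with
    | zero => simp
    | of i a => rw [DirectSum.coeAddMonoidHom_of]; exact AddSubgroup.mem_iSup_of_mem i a.2
    | add x y hx hy => rw [map_add]; exact add_mem hx hy

theorem polyGr_internal (V : Type*) [AddCommGroup V] [Module ℝ V] :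
    DirectSum.IsInternal fun d => (polyGr V d).toAddSubgroup := by
  let ψ : PolyRing V →ₐ[ℝ] Polynomial (PolyRing V) :=
    SymmetricAlgebra.lift
      { toFun := fun f => Polynomial.C (SymmetricAlgebra.ι ℝ _ f) * Polynomial.X
        map_add' := fun f g => by simp [add_mul]
        map_smul' := fun r f => by
          rw [RingHom.id_apply, map_smul, ← Polynomial.smul_C, smul_mul_assoc] }
  have hψ : ∀ l : List (Dual ℝ V), ψ (l.map (SymmetricAlgebra.ι ℝ (Dual ℝ V))).prod =
      Polynomial.C (l.map (SymmetricAlgebra.ι ℝ (Dual ℝ V))).prod * Polynomial.X ^ l.length := by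
    intro l
    induction l with
    | nil => simp
    | cons a l ih =>
      have ha : ψ (SymmetricAlgebra.ι ℝ _ a) =
          Polynomial.C (SymmetricAlgebra.ι ℝ _ a) * Polynomial.X := by simp [ψ]
      rw [List.map_cons, List.prod_cons, map_mul, ih, ha, map_mul, List.length_cons, pow_succ]
      ring
  refine isInternal_of _ (AddMonoidHom.mk'
    (fun f (d : ℤ) => if 0 ≤ d ∧ d % 2 = 0 then (ψ f).coeff (d / 2).toNat else 0) ?_) ?_ ?_
  · intro f g
    ext d
    simp only [map_add, Polynomial.coeff_add, Pi.add_apply]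
    split_ifs <;> simp
  · intro d a ha
    ext i
    rw [AddMonoidHom.mk'_apply]
    change a ∈ polyGr V d at ha
    induction ha using Submodule.span_induction with
    | mem f hf =>
      obtain ⟨l, hl, rfl⟩ := hf
      rw [hψ, Polynomial.coeff_C_mul, Polynomial.coeff_X_pow]
      by_cases h : i = d
      · subst h
        rw [if_pos (by omega), if_pos (by omega), Pi.single_eq_same, mul_one]
      · rw [Pi.single_eq_of_ne h]
        split_ifs with h1 h2
        · omega
        · simp
        · rfl
    | zero => simp
    | add f g _ _ hf hg =>
      rw [Pi.single_add, Pi.add_apply, ← hf, ← hg]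
      split_ifs <;> simp
    | smul r f _ hf =>
      rw [Pi.single_smul, Pi.smul_apply, ← hf]
      split_ifs <;> simp
  · intro f
    have hpos : ∀ (d : ℤ) {f : PolyRing V}, f ∈ polyGr V d →
        f ∈ ⨆ d, (polyGr V d).toAddSubgroup := fun d f hf =>
      AddSubgroup.mem_iSup_of_mem (S := fun d => (polyGr V d).toAddSubgroup) d hf
    induction f using SymmetricAlgebra.induction with
    | algebraMap r => exact hpos 0 (polyGr_algebraMap r)
    | ι f => exact hpos 2 (polyGr_ι f)
    | mul a b ha hb =>
      refine AddSubgroup.iSup_induction _ (C := fun a => a * b ∈ _) ha ?_ ?_ ?_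
      · intro i a ha
        refine AddSubgroup.iSup_induction _ (C := fun b => a * b ∈ _) hb ?_ ?_ ?_
        · exact fun j b hb => hpos _ (polyGr_mul ha hb)
        · rw [mul_zero]; exact zero_mem _
        · intro x y hx hy
          rw [mul_add]; exact add_mem hx hy
      · rw [zero_mul]; exact zero_mem _
      · intro x y hx hy
        rw [add_mul]; exact add_mem hx hy
    | add a b ha hb => exact add_mem ha hb


/-! ### Bott-Samelson bimodules -/

/-- A commutative ring with two ring homomorphisms from `R` (the left and the right structure of an
`R`-bimodule), a compatible grading, and a left `R`-linear trace to `R`. This only serves to carry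
out the recursive construction of the Bott-Samelson bimodules below. -/
structure BSData.{u} (V : Type u) [AddCommGroup V] [Module ℝ V] where
  carrier : Type u
  [commRing : CommRing carrier]
  left : PolyRing V →+* carrier
  right : PolyRing V →+* carrier
  left_eq_right : ∀ r : ℝ, left (algebraMap ℝ _ r) = right (algebraMap ℝ _ r)
  gr : ℤ → AddSubgroup carrier
  isInternal : DirectSum.IsInternal gr
  left_mul_mem : ∀ {i j : ℤ} {f : PolyRing V} {b : carrier},
    f ∈ polyGr V i → b ∈ gr j → left f * b ∈ gr (i + j)
  right_mul_mem : ∀ {i j : ℤ} {f : PolyRing V} {b : carrier},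
    f ∈ polyGr V i → b ∈ gr j → right f * b ∈ gr (i + j)
  trace : carrier →+ PolyRing V
  trace_left_mul : ∀ (f : PolyRing V) (b : carrier), trace (left f * b) = f * trace b

attribute [instance] BSData.commRing

/-- The bimodule `R` itself, which belongs to the empty word; the trace is the identity. -/
def BSData.unit.{u} (V : Type u) [AddCommGroup V] [Module ℝ V] : BSData V where
  carrier := PolyRing V
  left := RingHom.id _
  right := RingHom.id _
  left_eq_right _ := rfl
  gr d := (polyGr V d).toAddSubgroup
  isInternal := polyGr_internal V
  left_mul_mem hf hb := polyGr_mul hf hb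
  right_mul_mem hf hb := polyGr_mul hf hb
  trace := AddMonoidHom.id _
  trace_left_mul _ _ := rfl

end

section step
open TensorProduct

universe u
variable {I W : Type*} {V : Type u} [Group W] {M : CoxeterMatrix I}
  [AddCommGroup V] [Module ℝ V]

/-- `C` regarded as an `R^s`-algebra through its left structure. -/
def Restrict (_cs : CoxeterSystem M W) (_H : Realisation M V) (_s : I) (C : BSData V) : Type u :=
  C.carrier

variable (cs : CoxeterSystem M W) (H : Realisation M V) (s : I) (C : BSData V)

instance : CommRing (Restrict cs H s C) := C.commRing

noncomputable instance : Algebra (invariants cs H s) (Restrict cs H s C) :=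
  (C.left.comp (invariants cs H s).val.toRingHom).toAlgebra

theorem Restrict.smul_def (a : invariants cs H s) (b : Restrict cs H s C) :
    a • b = (show Restrict cs H s C from C.left a.1 * (show C.carrier from b)) := rfl

/-- The ring `R ⊗_{R^s} C`. As a bimodule it is `B(s) ⊗_R C` up to a shift of the grading, where
`B(s) = R ⊗_{R^s} R [1]`. -/
def Induced : Type u := PolyRing V ⊗[invariants cs H s] Restrict cs H s C

noncomputable instance : CommRing (Induced cs H s C) :=
  inferInstanceAs (CommRing (PolyRing V ⊗[invariants cs H s] Restrict cs H s C))

variable {C} in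
/-- The pure tensor `f ⊗ b` in `R ⊗_{R^s} C`. -/
noncomputable def tmk (f : PolyRing V) (b : C.carrier) : Induced cs H s C :=
  f ⊗ₜ[invariants cs H s] (show Restrict cs H s C from b)

variable {C}

theorem tmk_mul_left (a f : PolyRing V) (ha : polyAct cs H (cs.simple s) a = a) (b : C.carrier) :
    tmk cs H s f (C.left a * b) = tmk cs H s (f * a) b := by
  have := (TensorProduct.smul_tmul (R := invariants cs H s) (⟨a, ha⟩ : invariants cs H s) f
    (show Restrict cs H s C from b)).symm
  rw [tmk, tmk, mul_comm f a]
  exact this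

theorem tmk_add (f g : PolyRing V) (b : C.carrier) :
    tmk cs H s (f + g) b = tmk cs H s f b + tmk cs H s g b := TensorProduct.add_tmul _ _ _

theorem tmk_add_right (f : PolyRing V) (b c : C.carrier) :
    tmk cs H s f (b + c) = tmk cs H s f b + tmk cs H s f c := TensorProduct.tmul_add _ _ _

theorem tmk_zero (f : PolyRing V) : tmk cs H s f (0 : C.carrier) = 0 :=
  TensorProduct.tmul_zero _ _

theorem zero_tmk (b : C.carrier) : tmk cs H s 0 b = 0 := TensorProduct.zero_tmul _ _

theorem tmk_mul (f g : PolyRing V) (b c : C.carrier) :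
    tmk cs H s f b * tmk cs H s g c = tmk cs H s (f * g) (b * c) :=
  Algebra.TensorProduct.tmul_mul_tmul _ _ _ _

theorem induced_induction {p : Induced cs H s C → Prop} (z : Induced cs H s C)
    (h0 : p 0) (ht : ∀ f b, p (tmk cs H s f b)) (ha : ∀ x y, p x → p y → p (x + y)) : p z :=
  TensorProduct.induction_on z h0 ht ha

variable (C) in
/-- The tensor product grading on `B(s) ⊗_R C = R ⊗_{R^s} C [1]`: the degree of `f ⊗ b` is
`deg f + deg b - 1`. -/
noncomputable def stepGr (d : ℤ) : AddSubgroup (Induced cs H s C) :=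
  AddSubgroup.closure {z | ∃ (i j : ℤ) (f : PolyRing V) (b : C.carrier),
    f ∈ polyGr V i ∧ b ∈ C.gr j ∧ i + j - 1 = d ∧ z = tmk cs H s f b}

/-- The component `(f + s f) / 2 ∈ R^s` of `f` in `R = R^s ⊕ α_s R^s`. -/
noncomputable def symPart : PolyRing V →+ PolyRing V :=
  AddMonoidHom.mk' (fun f => (1 / 2 : ℝ) • (f + polyAct cs H (cs.simple s) f))
    (fun f g => by rw [map_add, ← smul_add]; congr 1; ring)

/-- The element `a = ∂_s f / 2 ∈ R^s`, such that `α_s a` is the other component of `f`. -/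
noncomputable def antiPart : PolyRing V →+ PolyRing V :=
  AddMonoidHom.mk' (fun f => (1 / 2 : ℝ) • demazure cs H s f)
    (fun f g => by rw [demazure_add, smul_add])

theorem act_act (f : PolyRing V) :
    polyAct cs H (cs.simple s) (polyAct cs H (cs.simple s) f) = f := by
  rw [← AlgHom.mul_apply, ← map_mul, cs.simple_mul_simple_self, map_one, AlgHom.one_apply]

theorem act_root : polyAct cs H (cs.simple s) (SymmetricAlgebra.ι ℝ _ (H.root s)) =
    -SymmetricAlgebra.ι ℝ _ (H.root s) := by
  rw [polyAct_ι, H.dualRep_simple, H.root_coroot_self, map_sub, map_smul]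
  module

theorem act_demazure (f : PolyRing V) :
    polyAct cs H (cs.simple s) (demazure cs H s f) = demazure cs H s f := by
  symm
  apply demazure_eq
  have h := congrArg (polyAct cs H (cs.simple s)) (root_mul_demazure cs H s f)
  rw [map_mul, act_root, map_sub, act_act] at h
  linear_combination -h

theorem act_symPart (f : PolyRing V) :
    polyAct cs H (cs.simple s) (symPart cs H s f) = symPart cs H s f := by
  simp only [symPart, AddMonoidHom.mk'_apply, map_smul, map_add, act_act, add_comm]

theorem act_antiPart (f : PolyRing V) :
    polyAct cs H (cs.simple s) (antiPart cs H s f) = antiPart cs H s f := by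
  simp only [antiPart, AddMonoidHom.mk'_apply, map_smul, act_demazure]

theorem symPart_add_antiPart (f : PolyRing V) :
    symPart cs H s f + SymmetricAlgebra.ι ℝ _ (H.root s) * antiPart cs H s f = f := by
  simp only [symPart, antiPart, AddMonoidHom.mk'_apply, mul_smul_comm, root_mul_demazure]
  module

theorem demazure_mul_inv (a f : PolyRing V) (ha : polyAct cs H (cs.simple s) a = a) :
    demazure cs H s (a * f) = a * demazure cs H s f := by
  rw [demazure_mul, ha, demazure_of_inv cs H s ha, zero_mul, zero_add]

/-- First component of the isomorphism of `R ⊗_{R^s} C = 1 ⊗ C ⊕ α_s ⊗ C` with `C ⊕ C`. -/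
noncomputable def projSym : Induced cs H s C →+ C.carrier :=
  TensorProduct.liftAddHom (R := invariants cs H s)
    (M := PolyRing V) (N := Restrict cs H s C) (P := C.carrier)
    ((AddMonoidHom.mul (R := C.carrier)).comp (C.left.toAddMonoidHom.comp (symPart cs H s)))
    (by
      rintro ⟨a, ha⟩ f (b : C.carrier)
      change polyAct cs H (cs.simple s) a = a at ha
      change C.left (symPart cs H s (a * f)) * b = C.left (symPart cs H s f) * (C.left a * b)
      rw [← mul_assoc, ← map_mul]
      congr 2
      simp only [symPart, AddMonoidHom.mk'_apply, map_mul, ha, smul_mul_assoc]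
      congr 1
      ring)

/-- Second component of the isomorphism of `R ⊗_{R^s} C = 1 ⊗ C ⊕ α_s ⊗ C` with `C ⊕ C`. -/
noncomputable def projAnti : Induced cs H s C →+ C.carrier :=
  TensorProduct.liftAddHom (R := invariants cs H s)
    (M := PolyRing V) (N := Restrict cs H s C) (P := C.carrier)
    ((AddMonoidHom.mul (R := C.carrier)).comp (C.left.toAddMonoidHom.comp (antiPart cs H s)))
    (by
      rintro ⟨a, ha⟩ f (b : C.carrier)
      change polyAct cs H (cs.simple s) a = a at ha
      change C.left (antiPart cs H s (a * f)) * b = C.left (antiPart cs H s f) * (C.left a * b)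
      rw [← mul_assoc, ← map_mul]
      congr 2
      simp only [antiPart, AddMonoidHom.mk'_apply, demazure_mul_inv cs H s a f ha, smul_mul_assoc]
      rw [mul_comm])

theorem projSym_tmk (f : PolyRing V) (b : C.carrier) :
    projSym cs H s (tmk cs H s f b) = C.left (symPart cs H s f) * b := rfl

theorem projAnti_tmk (f : PolyRing V) (b : C.carrier) :
    projAnti cs H s (tmk cs H s f b) = C.left (antiPart cs H s f) * b := rfl

theorem tmk_eq (f : PolyRing V) (b : C.carrier) :
    tmk cs H s f b = tmk cs H s 1 (C.left (symPart cs H s f) * b) +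
      tmk cs H s (SymmetricAlgebra.ι ℝ _ (H.root s)) (C.left (antiPart cs H s f) * b) := by
  rw [tmk_mul_left cs H s _ _ (act_symPart cs H s f),
    tmk_mul_left cs H s _ _ (act_antiPart cs H s f), ← tmk_add, one_mul, symPart_add_antiPart]

theorem eq_proj (z : Induced cs H s C) :
    z = tmk cs H s 1 (projSym cs H s z) +
      tmk cs H s (SymmetricAlgebra.ι ℝ _ (H.root s)) (projAnti cs H s z) := by
  induction z using induced_induction with
  | h0 => simp [tmk_zero]
  | ht f b => exact tmk_eq cs H s f b
  | ha x y hx hy =>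
    conv_lhs => rw [hx, hy]
    rw [map_add, map_add, tmk_add_right, tmk_add_right]
    abel

theorem projSym_mem {d : ℤ} {z : Induced cs H s C} (hz : z ∈ stepGr cs H s C d) :
    projSym cs H s z ∈ C.gr (d + 1) := by
  induction hz using AddSubgroup.closure_induction with
  | mem z hz =>
    obtain ⟨i, j, f, b, hf, hb, rfl, rfl⟩ := hz
    rw [projSym_tmk]
    have : i + j - 1 + 1 = i + j := by ring
    rw [this]
    refine C.left_mul_mem ?_ hb
    exact Submodule.smul_mem _ _ (add_mem hf (polyGr_act cs H _ hf))
  | zero => rw [map_zero]; exact zero_mem _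
  | add x y _ _ hx hy => rw [map_add]; exact add_mem hx hy
  | neg x _ hx => rw [map_neg]; exact neg_mem hx

theorem projAnti_mem {d : ℤ} {z : Induced cs H s C} (hz : z ∈ stepGr cs H s C d) :
    projAnti cs H s z ∈ C.gr (d - 1) := by
  induction hz using AddSubgroup.closure_induction with
  | mem z hz =>
    obtain ⟨i, j, f, b, hf, hb, rfl, rfl⟩ := hz
    rw [projAnti_tmk]
    have : i + j - 1 - 1 = (i - 2) + j := by ring
    rw [this]
    refine C.left_mul_mem ?_ hb
    exact Submodule.smul_mem _ _ (polyGr_demazure cs H s hf)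
  | zero => rw [map_zero]; exact zero_mem _
  | add x y _ _ hx hy => rw [map_add]; exact add_mem hx hy
  | neg x _ hx => rw [map_neg]; exact neg_mem hx

theorem tmk_mem {i j d : ℤ} {f : PolyRing V} {b : C.carrier} (hf : f ∈ polyGr V i)
    (hb : b ∈ C.gr j) (h : i + j - 1 = d) : tmk cs H s f b ∈ stepGr cs H s C d :=
  AddSubgroup.subset_closure ⟨i, j, f, b, hf, hb, h, rfl⟩

theorem stepGr_internal : DirectSum.IsInternal (stepGr cs H s C) := by
  obtain ⟨⟨φ, hφ⟩, hC⟩ := exists_components C.isInternal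
  obtain ⟨_, hR⟩ := exists_components (polyGr_internal V)
  refine isInternal_of _ (AddMonoidHom.mk' (fun z d =>
    tmk cs H s 1 (φ (projSym cs H s z) (d + 1)) +
      tmk cs H s (SymmetricAlgebra.ι ℝ _ (H.root s)) (φ (projAnti cs H s z) (d - 1))) ?_) ?_ ?_
  · intro x y
    ext d
    simp only [map_add, Pi.add_apply, tmk_add_right]
    abel
  · intro d z hz
    ext i
    rw [AddMonoidHom.mk'_apply, hφ _ _ (projSym_mem cs H s hz), hφ _ _ (projAnti_mem cs H s hz)]
    by_cases h : i = d
    · subst h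
      rw [Pi.single_eq_same, Pi.single_eq_same, Pi.single_eq_same, ← eq_proj]
    · rw [Pi.single_eq_of_ne h, Pi.single_eq_of_ne (by omega), Pi.single_eq_of_ne (by omega)]
      simp [tmk_zero]
  · intro z
    induction z using induced_induction with
    | h0 => exact zero_mem _
    | ha x y hx hy => exact add_mem hx hy
    | ht f b =>
      refine AddSubgroup.iSup_induction _ (C := fun f => tmk cs H s f b ∈ _) (hR f) ?_ ?_ ?_
      · intro i f hf
        refine AddSubgroup.iSup_induction _ (C := fun b => tmk cs H s f b ∈ _) (hC b) ?_ ?_ ?_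
        · exact fun j b hb => AddSubgroup.mem_iSup_of_mem (i + j - 1) (tmk_mem cs H s hf hb rfl)
        · simp [tmk_zero]
        · intro x y hx hy
          rw [tmk_add_right]; exact add_mem hx hy
      · simp [zero_tmk]
      · intro x y hx hy
        rw [tmk_add]; exact add_mem hx hy

/-- The trace `f ⊗ b ↦ f ∂_s (Tr b)` on `R ⊗_{R^s} C`. -/
noncomputable def stepTrace : Induced cs H s C →+ PolyRing V :=
  TensorProduct.liftAddHom (R := invariants cs H s)
    (M := PolyRing V) (N := Restrict cs H s C) (P := PolyRing V)
    (AddMonoidHom.mk'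
      (fun f => (AddMonoidHom.mulLeft f).comp ((demazureHom cs H s).comp C.trace))
      (fun f g => by ext (b : C.carrier); exact add_mul f g _))
    (by
      rintro ⟨a, ha⟩ f (b : C.carrier)
      change polyAct cs H (cs.simple s) a = a at ha
      change (a * f) * demazure cs H s (C.trace b) =
        f * demazure cs H s (C.trace (C.left a * b))
      rw [C.trace_left_mul, demazure_mul_inv cs H s a _ ha]
      ring)

theorem stepTrace_tmk (f : PolyRing V) (b : C.carrier) :
    stepTrace cs H s (tmk cs H s f b) = f * demazure cs H s (C.trace b) := rfl

variable (C)

/-- The bimodule `B(s) ⊗_R C`, with left action on the factor `R`, right action on the factor `C`. -/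
noncomputable def BSData.step : BSData V where
  carrier := Induced cs H s C
  left := (Algebra.TensorProduct.includeLeftRingHom :
    PolyRing V →+* PolyRing V ⊗[invariants cs H s] Restrict cs H s C)
  right := (Algebra.TensorProduct.includeRight :
    Restrict cs H s C →ₐ[invariants cs H s]
      PolyRing V ⊗[invariants cs H s] Restrict cs H s C).toRingHom.comp C.right
  left_eq_right r := by
    change tmk cs H s (algebraMap ℝ _ r) (1 : C.carrier) =
      tmk cs H s 1 (C.right (algebraMap ℝ _ r))
    rw [← C.left_eq_right, ← mul_one (C.left _), tmk_mul_left cs H s _ _ (AlgHom.commutes _ r),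
      one_mul]
  gr := stepGr cs H s C
  isInternal := stepGr_internal cs H s
  left_mul_mem := by
    intro i j f z hf hz
    change tmk cs H s f 1 * z ∈ _
    induction hz using AddSubgroup.closure_induction with
    | mem z hz =>
      obtain ⟨k, l, g, b, hg, hb, rfl, rfl⟩ := hz
      rw [tmk_mul, one_mul]
      exact tmk_mem cs H s (polyGr_mul hf hg) hb (by ring)
    | zero => rw [mul_zero]; exact zero_mem _
    | add x y _ _ hx hy => rw [mul_add]; exact add_mem hx hy
    | neg x _ hx => rw [mul_neg]; exact neg_mem hx
  right_mul_mem := by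
    intro i j f z hf hz
    change tmk cs H s 1 (C.right f) * z ∈ _
    induction hz using AddSubgroup.closure_induction with
    | mem z hz =>
      obtain ⟨k, l, g, b, hg, hb, rfl, rfl⟩ := hz
      rw [tmk_mul, one_mul]
      exact tmk_mem cs H s hg (C.right_mul_mem hf hb) (by ring)
    | zero => rw [mul_zero]; exact zero_mem _
    | add x y _ _ hx hy => rw [mul_add]; exact add_mem hx hy
    | neg x _ hx => rw [mul_neg]; exact neg_mem hx
  trace := stepTrace cs H s
  trace_left_mul f z := by
    change stepTrace cs H s (tmk cs H s f 1 * z) = f * stepTrace cs H s z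
    induction z using induced_induction with
    | h0 => simp
    | ht g b => rw [tmk_mul, one_mul, stepTrace_tmk, stepTrace_tmk]; ring
    | ha x y hx hy => rw [mul_add, map_add, map_add, hx, hy]; ring

/-- The Bott-Samelson bimodule `B(s₁) ⊗_R ⋯ ⊗_R B(s_m)` of the word `s₁ ⋯ s_m`, with its ring
structure, its grading, and its trace `f₀ ⊗ ⋯ ⊗ f_m ↦ f₀ ∂_{s₁}(f₁ ∂_{s₂}(f₂ ⋯ ∂_{s_m}(f_m)))`.
This trace is the coefficient of `c_{s₁} ⋯ c_{s_m}` in the left basis `c_π` of products of the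
elements `c_id = 1 ⊗ 1` and `c_s = (α_s ⊗ 1 + 1 ⊗ α_s) / 2`: see `trace_cElem`, `closure_cElem`. -/
noncomputable def bsData : List I → BSData V
  | [] => BSData.unit V
  | s :: ω => BSData.step cs H s (bsData ω)


variable {C}

/-- The product in `B(s) ⊗_R C` of `c_s` (if `b` is true) or `c_id` (if not) with `c ∈ C`. -/
noncomputable def stepC (b : Bool) (c : C.carrier) : Induced cs H s C :=
  if b then
    tmk cs H s ((1 / 2 : ℝ) • SymmetricAlgebra.ι ℝ _ (H.root s)) c +
      tmk cs H s 1 (C.left ((1 / 2 : ℝ) • SymmetricAlgebra.ι ℝ _ (H.root s)) * c)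
  else tmk cs H s 1 c

theorem stepTrace_stepC (b : Bool) (c : C.carrier) (p : Prop) [Decidable p]
    (h : C.trace c = if p then 1 else 0) :
    stepTrace cs H s (stepC cs H s b c) = if b = true ∧ p then 1 else 0 := by
  have hd : demazure cs H s (C.trace c) = 0 := by
    apply demazure_of_inv
    rw [h]
    split_ifs <;> simp
  cases b with
  | false => simp [stepC, stepTrace_tmk, hd]
  | true =>
    simp only [stepC, if_true, map_add, stepTrace_tmk, C.trace_left_mul, hd, mul_zero, zero_add,
      one_mul, true_and]
    rw [h]
    split_ifs
    · rw [mul_one, demazure_smul, demazure_ι, H.root_coroot_self, Algebra.smul_def, ← map_mul]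
      norm_num
    · rw [mul_zero, demazure_of_inv cs H s (map_zero _)]

theorem mem_of_stepC (G : Set C.carrier)
    (hG : ∀ z, z ∈ AddSubgroup.closure {b | ∃ (f : PolyRing V) (c : C.carrier), c ∈ G ∧
      b = C.left f * c})
    (T : AddSubgroup (Induced cs H s C))
    (hT : ∀ (f : PolyRing V) (b : Bool), ∀ c ∈ G, tmk cs H s f 1 * stepC cs H s b c ∈ T)
    (z : Induced cs H s C) : z ∈ T := by
  have h0 : ∀ (f : PolyRing V), ∀ c ∈ G, tmk cs H s f c ∈ T := by
    intro f c hc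
    have h := hT f false c hc
    simpa [stepC, tmk_mul] using h
  have h1 : ∀ (f : PolyRing V), ∀ c ∈ G,
      tmk cs H s f (C.left (SymmetricAlgebra.ι ℝ _ (H.root s)) * c) ∈ T := by
    intro f c hc
    have h := sub_mem (hT ((2 : ℝ) • f) true c hc)
      (h0 (f * SymmetricAlgebra.ι ℝ _ (H.root s)) c hc)
    have hl : C.left ((1 / 2 : ℝ) • SymmetricAlgebra.ι ℝ _ (H.root s)) =
        C.left (algebraMap ℝ _ (1 / 2 : ℝ)) * C.left (SymmetricAlgebra.ι ℝ _ (H.root s)) := by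
      rw [← map_mul, Algebra.smul_def]
    have e : tmk cs H s ((2 : ℝ) • f) 1 * stepC cs H s true c =
        tmk cs H s (f * SymmetricAlgebra.ι ℝ _ (H.root s)) c +
          tmk cs H s f (C.left (SymmetricAlgebra.ι ℝ _ (H.root s)) * c) := by
      simp only [stepC, if_true]
      rw [mul_add, tmk_mul, tmk_mul, one_mul, one_mul, mul_one, hl, mul_assoc,
        tmk_mul_left cs H s _ _ (AlgHom.commutes _ _), mul_comm _ (algebraMap ℝ _ _),
        ← Algebra.smul_def, smul_smul, smul_mul_smul_comm]
      norm_num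
    rwa [e, add_sub_cancel_left] at h
  induction z using induced_induction with
  | h0 => exact zero_mem T
  | ha x y hx hy => exact add_mem hx hy
  | ht f b =>
    have hb := hG b
    induction hb using AddSubgroup.closure_induction with
    | zero => rw [tmk_zero]; exact zero_mem T
    | add x y _ _ hx hy => rw [tmk_add_right]; exact add_mem hx hy
    | neg x _ hx =>
      have e : tmk cs H s f (-x) = -tmk cs H s f x := by
        rw [eq_neg_iff_add_eq_zero, ← tmk_add_right, neg_add_cancel, tmk_zero]
      rw [e]
      exact neg_mem hx
    | mem b hb =>
      obtain ⟨r, c, hc, rfl⟩ := hb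
      rw [← symPart_add_antiPart cs H s r, map_add, add_mul, tmk_add_right, mul_comm
        (SymmetricAlgebra.ι ℝ _ (H.root s)), map_mul, mul_assoc,
        tmk_mul_left cs H s _ _ (act_symPart cs H s r),
        tmk_mul_left cs H s _ _ (act_antiPart cs H s r)]
      exact add_mem (h0 _ _ hc) (h1 _ _ hc)

/-- The element `c_π = c_{u₁} ⋯ c_{u_m}` of the Bott-Samelson bimodule, where `u_i = s_i` if the
corresponding value of `π` is true, and `u_i = id` if not. -/
noncomputable def cElem : (ω : List I) → (ℕ → Bool) → (bsData cs H ω).carrier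
  | [], _ => (1 : PolyRing V)
  | s :: ω, π => stepC cs H s (π 0) (cElem ω fun n => π (n + 1))

/-- The trace of `c_π` is `1` if `π` selects the full word, and `0` otherwise. -/
theorem trace_cElem (ω : List I) (π : ℕ → Bool) :
    (bsData cs H ω).trace (cElem cs H ω π) =
      if ∀ n < ω.length, π n = true then 1 else 0 := by
  induction ω generalizing π with
  | nil =>
    rw [if_pos (by simp)]
    rfl
  | cons s ω ih =>
    have hiff : (∀ n < (s :: ω).length, π n = true) ↔
        π 0 = true ∧ ∀ n < ω.length, π (n + 1) = true := by
      constructor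
      · exact fun h => ⟨h 0 (by simp), fun n hn => h (n + 1) (by simpa using hn)⟩
      · rintro ⟨h0, h1⟩ n hn
        cases n with
        | zero => exact h0
        | succ n => exact h1 n (by simpa using hn)
    rw [if_congr hiff rfl rfl]
    exact stepTrace_stepC cs H s (π 0) _ _ (ih fun n => π (n + 1))

/-- The elements `c_π` generate the Bott-Samelson bimodule as a left `R`-module. -/
theorem closure_cElem (ω : List I) (z : (bsData cs H ω).carrier) :
    z ∈ AddSubgroup.closure
      {b | ∃ (f : PolyRing V) (c : (bsData cs H ω).carrier), c ∈ Set.range (cElem cs H ω) ∧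
        b = (bsData cs H ω).left f * c} := by
  induction ω with
  | nil =>
    refine AddSubgroup.subset_closure ⟨z, _, ⟨fun _ => true, rfl⟩, ?_⟩
    exact (mul_one (show PolyRing V from z)).symm
  | cons s ω ih =>
    refine mem_of_stepC cs H s (Set.range (cElem cs H ω)) ih _ ?_ z
    rintro f b _ ⟨π, rfl⟩
    exact AddSubgroup.subset_closure ⟨f, _, ⟨fun n => Nat.casesOn n b π, rfl⟩, rfl⟩

end step

/-! ### Graded bimodules, stalks, costalks and local forms -/
section bimod
universe u v v'

/-- A graded `R`-bimodule on which `ℝ` acts centrally. The right action of `f` on `b` is written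
`MulOpposite.op f • b`, and `gr d` is the homogeneous part of degree `d`. -/
structure GradedBimodule (V : Type u) [AddCommGroup V] [Module ℝ V] where
  carrier : Type v
  [addCommGroup : AddCommGroup carrier]
  [module : Module (PolyRing V) carrier]
  [moduleOp : Module (PolyRing V)ᵐᵒᵖ carrier]
  [smulComm : SMulCommClass (PolyRing V) (PolyRing V)ᵐᵒᵖ carrier]
  real_central : ∀ (r : ℝ) (b : carrier),
    MulOpposite.op (algebraMap ℝ (PolyRing V) r) • b = algebraMap ℝ (PolyRing V) r • b
  gr : ℤ → AddSubgroup carrier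
  isInternal : DirectSum.IsInternal gr
  smul_mem : ∀ {i j : ℤ} {f : PolyRing V} {b : carrier},
    f ∈ polyGr V i → b ∈ gr j → f • b ∈ gr (i + j)
  op_smul_mem : ∀ {i j : ℤ} {f : PolyRing V} {b : carrier},
    f ∈ polyGr V i → b ∈ gr j → MulOpposite.op f • b ∈ gr (i + j)

attribute [instance] GradedBimodule.addCommGroup GradedBimodule.module
  GradedBimodule.moduleOp GradedBimodule.smulComm

variable {I W : Type*} {V : Type u} [Group W] {M : CoxeterMatrix I}
  [AddCommGroup V] [Module ℝ V]

namespace GradedBimodule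

/-- Bimodule homomorphisms `B → B'` of degree `n`, that is, degree zero morphisms `B → B'[n]`. -/
structure Hom (B : GradedBimodule.{u, v} V) (B' : GradedBimodule.{u, v'} V) (n : ℤ) where
  toLinearMap : B.carrier →ₗ[PolyRing V] B'.carrier
  map_op_smul : ∀ (f : PolyRing V) (b : B.carrier),
    toLinearMap (MulOpposite.op f • b) = MulOpposite.op f • toLinearMap b
  map_gr : ∀ (d : ℤ), ∀ b ∈ B.gr d, toLinearMap b ∈ B'.gr (d + n)

/-- `B` is isomorphic to a direct summand of the shifted graded bimodule `B'[k]`. -/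
def IsShiftedSummand (B : GradedBimodule.{u, v} V) (B' : GradedBimodule.{u, v'} V) (k : ℤ) :
    Prop :=
  ∃ (i : Hom B B' k) (p : Hom B' B (-k)), ∀ b, p.toLinearMap (i.toLinearMap b) = b

/-- `B` is indecomposable as a graded bimodule: it is not zero, and its only idempotent degree zero
endomorphisms are `0` and the identity. -/
def IsIndecomposable (B : GradedBimodule.{u, v} V) : Prop :=
  Nontrivial B.carrier ∧ ∀ e : Hom B B 0,
    (∀ b, e.toLinearMap (e.toLinearMap b) = e.toLinearMap b) →
      (∀ b, e.toLinearMap b = 0) ∨ ∀ b, e.toLinearMap b = b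

end GradedBimodule

/-- The underlying graded bimodule. -/
noncomputable def BSData.toGradedBimodule (C : BSData V) : GradedBimodule.{u, u} V where
  carrier := C.carrier
  module := Module.compHom C.carrier C.left
  moduleOp := Module.compHom C.carrier (C.right.fromOpposite fun _ _ => Commute.all _ _)
  smulComm :=
    letI := Module.compHom C.carrier C.left
    letI := Module.compHom C.carrier (C.right.fromOpposite fun _ _ => Commute.all _ _)
    ⟨fun f g b => mul_left_comm (C.left f) (C.right g.unop) b⟩
  real_central r b := congrArg (fun a : C.carrier => a * b) (C.left_eq_right r).symm
  gr := C.gr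
  isInternal := C.isInternal
  smul_mem := C.left_mul_mem
  op_smul_mem := C.right_mul_mem

/-- The form `⟨b, b'⟩ = Tr (b b')`. -/
noncomputable def BSData.form (C : BSData V) :
    LinearMap.BilinForm (PolyRing V) C.toGradedBimodule.carrier :=
  LinearMap.mk₂ (PolyRing V)
    (fun b b' => C.trace ((show C.carrier from b) * (show C.carrier from b')))
    (fun a b c => (congrArg C.trace (add_mul (R := C.carrier) a b c)).trans (map_add _ _ _))
    (fun f a b => (congrArg C.trace (mul_assoc (G := C.carrier) (C.left f) a b)).trans
      (C.trace_left_mul _ _))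
    (fun a b c => (congrArg C.trace (mul_add (R := C.carrier) a b c)).trans (map_add _ _ _))
    (fun f a b => (congrArg C.trace (mul_left_comm (G := C.carrier) a (C.left f) b)).trans
      (C.trace_left_mul _ _))

/-- The Bott-Samelson bimodule `B(ω) = B(s₁) ⋯ B(s_m)` of the word `ω = s₁ ⋯ s_m`. -/
noncomputable def bottSamelson (cs : CoxeterSystem M W) (H : Realisation M V) (ω : List I) :
    GradedBimodule.{u, u} V :=
  (bsData cs H ω).toGradedBimodule

/-- The intersection form `⟨b, b'⟩ = Tr (b b')` on the Bott-Samelson bimodule `B(ω)`. -/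
noncomputable def intersectionForm (cs : CoxeterSystem M W) (H : Realisation M V)
    (ω : List I) : LinearMap.BilinForm (PolyRing V) (bottSamelson cs H ω).carrier :=
  (bsData cs H ω).form

/-- `B` is (isomorphic to) the indecomposable self-dual Soergel bimodule `B(y)`: it is the
indecomposable summand of `B(ω)`, for a reduced word `ω` of `y`, that is not isomorphic to a shift
of a summand of the Bott-Samelson bimodule of any shorter word. -/
def IsIndecomposableSoergel (cs : CoxeterSystem M W) (H : Realisation M V) (y : W)
    (B : GradedBimodule.{u, v} V) : Prop :=
  B.IsIndecomposable ∧
  (∃ ω : List I, cs.IsReduced ω ∧ cs.wordProd ω = y ∧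
    B.IsShiftedSummand (bottSamelson cs H ω) 0) ∧
  ∀ ω : List I, ω.length < cs.length y →
    ∀ k : ℤ, ¬ B.IsShiftedSummand (bottSamelson cs H ω) k

/-- The costalk `B_x^!`: the largest submodule of `B` on which `b · r = x(r) · b` for all `r ∈ R`. -/
def costalk (cs : CoxeterSystem M W) (H : Realisation M V) (x : W)
    (B : GradedBimodule.{u, v} V) : Submodule (PolyRing V) B.carrier where
  carrier := {b | ∀ r : PolyRing V, MulOpposite.op r • b = polyAct cs H x r • b}
  add_mem' ha hb r := by rw [smul_add, smul_add, ha r, hb r]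
  zero_mem' r := by rw [smul_zero, smul_zero]
  smul_mem' f b hb r := by
    rw [← smul_comm f (MulOpposite.op r) b, hb r, smul_smul, smul_smul, mul_comm]

/-- The left submodule generated by all `b · r - x(r) · b`. -/
def stalkRelations (cs : CoxeterSystem M W) (H : Realisation M V) (x : W)
    (B : GradedBimodule.{u, v} V) : Submodule (PolyRing V) B.carrier :=
  Submodule.span (PolyRing V)
    {z | ∃ (r : PolyRing V) (b : B.carrier), z = MulOpposite.op r • b - polyAct cs H x r • b}

/-- The stalk `B_x`: the largest quotient of `B` on which `b · r = x(r) · b` for all `r ∈ R`. -/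
abbrev Stalk (cs : CoxeterSystem M W) (H : Realisation M V) (x : W)
    (B : GradedBimodule.{u, v} V) : Type v :=
  B.carrier ⧸ stalkRelations cs H x B

/-- The projection `B → B_x`. Its restriction to `B_x^!` is the canonical map `i_x : B_x^! → B_x`. -/
def toStalk (cs : CoxeterSystem M W) (H : Realisation M V) (x : W)
    (B : GradedBimodule.{u, v} V) : B.carrier →ₗ[PolyRing V] Stalk cs H x B :=
  (stalkRelations cs H x B).mkQ

/-- The degree `d` part of the stalk `B_x`. -/
def stalkGr (cs : CoxeterSystem M W) (H : Realisation M V) (x : W)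
    (B : GradedBimodule.{u, v} V) (d : ℤ) : AddSubgroup (Stalk cs H x B) :=
  (B.gr d).map (toStalk cs H x B).toAddMonoidHom

/-- `F` is the local intersection form on `B_x` of the form `β` on `B`: the `R`-bilinear `Q`-valued
form which corresponds to the restriction of `β` to `B_x^!` under the canonical map
`i_x : B_x^! → B_x`. -/
def IsLocalForm (cs : CoxeterSystem M W) (H : Realisation M V) (x : W)
    (B : GradedBimodule.{u, v} V) (β : LinearMap.BilinForm (PolyRing V) B.carrier)
    (F : Stalk cs H x B →ₗ[PolyRing V] Stalk cs H x B →ₗ[PolyRing V] RootLoc cs H) : Prop :=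
  ∀ m ∈ costalk cs H x B, ∀ m' ∈ costalk cs H x B,
    F (toStalk cs H x B m) (toStalk cs H x B m') = algebraMap (PolyRing V) (RootLoc cs H) (β m m')

/-- The vector `c` spans `P` over `ℝ`. -/
def Generates (V : Type*) [AddCommGroup V] [Module ℝ V] {N : Type*} [AddCommGroup N] [Module (PolyRing V) N]
    (c : N) (P : AddSubgroup N) : Prop :=
  c ∈ P ∧ ∀ c' ∈ P, ∃ a : ℝ, c' = algebraMap ℝ (PolyRing V) a • c

end bimod
end Soergel

/-!
The Bott-Samelson bimodule `B(ω)` becomes completely explicit after localisation: `f₀ ⊗ ⋯ ⊗ f_m` is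
determined by the values `f₀ · s₁^{ε₁}(f₁) · s₁^{ε₁} s₂^{ε₂}(f₂) ⋯` in `R`, one for each subexpression
`ε` of `ω`, and right multiplication acts on the component of `ε` through the product `w(ε)` of the
subexpression. Expanding each `∂_s = (1 / α_s) (1 - s)` in the trace writes `Tr (b b')` as
`∑ κ_ε b_ε b'_ε`, where the `κ_ε ∈ Q` are the coefficients that appear when `D_{s₁} ⋯ D_{s_m}` is
multiplied out. In particular `∑_{w(ε) = x} κ_ε = e_{x,y}` (`bsFixedPoints`, `equivMult_eq_sum`).

A summand `B` of `B(ω)` inherits this embedding. Components with `w(ε) = x` factor through the stalk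
at `x`, and those with `w(ε) ≠ x` vanish on the costalk because `W` acts faithfully on linear forms.
So `∑_{w(ε) = x} κ_ε b_ε b'_ε` is a local intersection form. It is the only one: the canonical map
from the costalk to the stalk has torsion cokernel, and `Q` is a domain (`exists_smul_mem_costalk`,
`eq_localForm`). Finally `B(ω)` is zero below degree `-m` and spanned by `1 ⊗ ⋯ ⊗ 1` in degree `-m`.
All components of `1 ⊗ ⋯ ⊗ 1` are `1`, so its local form with itself is `e_{x,y}`, and other bottom
vectors change this by the square of a real number.

Two facts on Coxeter groups are needed and proved first. Roots are positive or negative according to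
length (`isPos_pairAct_simplePair`), which gives faithfulness and shows that the inversion roots of a
reduced word depend only on its product (`nodup_inversions`). From this it follows that `D_y` does
not depend on the reduced word (`nilDWord_well_defined`): by the Leibniz rule, the difference of two
candidates is a multiple of `δ_y`, and its coefficients sum to zero.
-/

namespace Soergel
namespace Realisation

/-! ### Positivity of roots -/

section roots
variable {I W V : Type*} [Group W] {M : CoxeterMatrix I} [AddCommGroup V] [Module ℝ V]

/-- The diagonal action of `W` on `V* × V`. A root and its coroot are handled as one vector here,
because both are obtained from a simple root and coroot by the same group element. -/
def pairAct (cs : CoxeterSystem M W) (H : Realisation M V) :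
    W →* (Dual ℝ V × V →ₗ[ℝ] Dual ℝ V × V) where
  toFun w := (H.dualRep cs w).prodMap (H.rep cs w).toLinearMap
  map_one' := by ext <;> simp
  map_mul' w w' := by ext <;> simp

/-- The pair `(α_s, α_s^∨)`. -/
def simplePair (H : Realisation M V) (s : I) : Dual ℝ V × V := (H.root s, H.coroot s)

/-- The linear combination of the pairs `(α_s, α_s^∨)` with given coefficients. -/
noncomputable def pairComb (H : Realisation M V) : (I →₀ ℝ) →ₗ[ℝ] Dual ℝ V × V :=
  Finsupp.linearCombination ℝ H.simplePair

/-- The pair is a combination of the simple pairs `(α_s, α_s^∨)` with nonnegative coefficients. -/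
def IsPos (H : Realisation M V) (z : Dual ℝ V × V) : Prop :=
  ∃ c : I →₀ ℝ, (∀ t, 0 ≤ c t) ∧ z = H.pairComb c

variable (cs : CoxeterSystem M W) (H : Realisation M V)

theorem pairComb_single (s : I) (r : ℝ) :
    H.pairComb (Finsupp.single s r) = r • H.simplePair s := by
  simp [pairComb]

theorem pairComb_fst (c : I →₀ ℝ) :
    (H.pairComb c).1 = Finsupp.linearCombination ℝ H.root c := by
  induction c using Finsupp.induction_linear with
  | zero => simp
  | add a b ha hb => rw [map_add, Prod.fst_add, ha, hb, map_add]
  | single s r => simp [pairComb_single, simplePair]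

theorem pairComb_injective : Function.Injective H.pairComb := by
  intro a b h
  apply H.linearIndependent_root
  rw [← pairComb_fst, ← pairComb_fst, h]

theorem root_coroot_comm (s t : I) : H.root s (H.coroot t) = H.root t (H.coroot s) := by
  rw [H.root_coroot, H.root_coroot, M.symmetric]

/-- The Cartan matrix is symmetric, so that the root and the coroot side of a pair in the span of
the simple pairs are reflected with the same coefficient. -/
theorem pairComb_pairing (c : I →₀ ℝ) (s : I) :
    H.root s (H.pairComb c).2 = (H.pairComb c).1 (H.coroot s) := by
  induction c using Finsupp.induction_linear with
  | zero => simp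
  | add a b ha hb => simp [ha, hb]
  | single t r => simp [pairComb_single, simplePair, root_coroot_comm H s t]

theorem pairAct_apply (w : W) (z : Dual ℝ V × V) :
    H.pairAct cs w z = (H.dualRep cs w z.1, H.rep cs w z.2) := rfl

theorem pairAct_simple (s : I) (z : Dual ℝ V × V) :
    H.pairAct cs (cs.simple s) z =
      (z.1 - z.1 (H.coroot s) • H.root s, z.2 - H.root s z.2 • H.coroot s) := by
  rw [pairAct_apply, dualRep_simple, rep_simple, simpleReflection_apply]

theorem pairAct_simple_comb (s : I) (c : I →₀ ℝ) :
    H.pairAct cs (cs.simple s) (H.pairComb c) =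
      H.pairComb (c - Finsupp.single s ((H.pairComb c).1 (H.coroot s))) := by
  rw [pairAct_simple, pairComb_pairing, map_sub, pairComb_single]
  ext <;> simp [simplePair]

theorem pairAct_simple_self (s : I) :
    H.pairAct cs (cs.simple s) (H.simplePair s) = -H.simplePair s := by
  rw [pairAct_simple, simplePair, root_coroot_self, Prod.neg_mk]
  exact Prod.ext (by module) (by module)

theorem pairAct_inv_cancel (w : W) (z : Dual ℝ V × V) :
    H.pairAct cs w⁻¹ (H.pairAct cs w z) = z := by
  rw [← Module.End.mul_apply, ← map_mul, inv_mul_cancel, map_one, Module.End.one_apply]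

theorem pairAct_cancel_inv (w : W) (z : Dual ℝ V × V) :
    H.pairAct cs w (H.pairAct cs w⁻¹ z) = z := by
  rw [← Module.End.mul_apply, ← map_mul, mul_inv_cancel, map_one, Module.End.one_apply]

theorem pairAct_injective (w : W) : Function.Injective (H.pairAct cs w) :=
  Function.LeftInverse.injective (g := H.pairAct cs w⁻¹) (pairAct_inv_cancel cs H w)

/-- The canonical pairing of the two components is invariant. -/
theorem pairAct_pairing (w : W) (z : Dual ℝ V × V) :
    (H.pairAct cs w z).1 (H.pairAct cs w z).2 = z.1 z.2 := by
  rw [pairAct_apply, dualRep_apply, ← LinearEquiv.mul_apply, ← map_mul, inv_mul_cancel, map_one]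
  rfl

theorem simplePair_pairing (s : I) : (H.simplePair s).1 (H.simplePair s).2 = 2 :=
  H.root_coroot_self s

variable {H} in
theorem IsPos.add {z z' : Dual ℝ V × V} (h : H.IsPos z) (h' : H.IsPos z') : H.IsPos (z + z') := by
  obtain ⟨c, hc, rfl⟩ := h
  obtain ⟨c', hc', rfl⟩ := h'
  exact ⟨c + c', fun t => add_nonneg (hc t) (hc' t), (map_add _ _ _).symm⟩

variable {H} in
theorem IsPos.smul {z : Dual ℝ V × V} (h : H.IsPos z) {r : ℝ} (hr : 0 ≤ r) : H.IsPos (r • z) := by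
  obtain ⟨c, hc, rfl⟩ := h
  exact ⟨r • c, fun t => mul_nonneg hr (hc t), (map_smul _ _ _).symm⟩

theorem isPos_simplePair (s : I) : H.IsPos (H.simplePair s) := by
  classical
  refine ⟨Finsupp.single s 1, fun t => ?_, by rw [pairComb_single, one_smul]⟩
  rw [Finsupp.single_apply]
  split_ifs <;> norm_num

variable {H} in
theorem IsPos.eq_zero_of_neg {z : Dual ℝ V × V} (h : H.IsPos z) (h' : H.IsPos (-z)) : z = 0 := by
  obtain ⟨c, hc, rfl⟩ := h
  obtain ⟨c', hc', h⟩ := h'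
  rw [← map_neg] at h
  have h := H.pairComb_injective h
  have : c = 0 := by
    ext t
    have h1 := DFunLike.congr_fun h t
    have h2 := hc t
    have h3 := hc' t
    simp only [Finsupp.coe_neg, Pi.neg_apply] at h1
    rw [Finsupp.zero_apply]
    linarith
  rw [this, map_zero]

/-- The numbers `sin (k θ) / sin θ` for `θ = π / m`, or their limit `k` for `m = ∞`. -/
noncomputable def sineRatio (m : ℕ) : ℕ → ℝ
  | 0 => 0
  | 1 => 1
  | k + 2 => 2 * Real.cos (Real.pi / m) * sineRatio m (k + 1) - sineRatio m k

theorem sineRatio_zero (k : ℕ) : sineRatio 0 k = k := by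
  induction k using Nat.twoStepInduction with
  | zero => simp [sineRatio]
  | one => simp [sineRatio]
  | more k h1 h2 =>
    rw [sineRatio, h1, h2]
    push_cast
    simp
    ring

theorem sin_mul_sineRatio (m k : ℕ) :
    Real.sin (Real.pi / m) * sineRatio m k = Real.sin (k * (Real.pi / m)) := by
  induction k using Nat.twoStepInduction with
  | zero => simp [sineRatio]
  | one => simp [sineRatio]
  | more k h1 h2 =>
    rw [sineRatio, mul_sub, h1, mul_left_comm, h2]
    have e1 : ((k + 2 : ℕ) : ℝ) * (Real.pi / m) =
        ((k + 1 : ℕ) : ℝ) * (Real.pi / m) + Real.pi / m := by push_cast; ring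
    have e2 : (k : ℝ) * (Real.pi / m) =
        ((k + 1 : ℕ) : ℝ) * (Real.pi / m) - Real.pi / m := by push_cast; ring
    rw [e1, e2, Real.sin_add, Real.sin_sub]
    ring

theorem sineRatio_nonneg {m k : ℕ} (hm1 : m ≠ 1) (hk : m ≠ 0 → k ≤ m) : 0 ≤ sineRatio m k := by
  rcases Nat.eq_zero_or_pos m with rfl | hm
  · rw [sineRatio_zero]; positivity
  have hkm := hk hm.ne'
  have hm0 : (0 : ℝ) < m := by exact_mod_cast hm
  have hm2 : (1 : ℝ) < m := by exact_mod_cast (by omega : 1 < m)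
  have hsin : 0 < Real.sin (Real.pi / m) :=
    Real.sin_pos_of_pos_of_lt_pi (by positivity) (div_lt_self Real.pi_pos hm2)
  have h := sin_mul_sineRatio m k
  have h2 : 0 ≤ Real.sin (k * (Real.pi / m)) := by
    apply Real.sin_nonneg_of_nonneg_of_le_pi (by positivity)
    rw [← mul_div_assoc, div_le_iff₀ hm0, mul_comm]
    exact mul_le_mul_of_nonneg_left (by exact_mod_cast hkm) Real.pi_pos.le
  rw [← h] at h2
  exact nonneg_of_mul_nonneg_right h2 hsin

/-- The roots of the dihedral subgroup generated by `s` and `t`. -/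
theorem pairAct_alternatingWord (s t : I) (k : ℕ) :
    H.pairAct cs (cs.wordProd (CoxeterSystem.alternatingWord s t k)) (H.simplePair s) =
      if Even k then sineRatio (M s t) (k + 1) • H.simplePair s +
        sineRatio (M s t) k • H.simplePair t
      else sineRatio (M s t) k • H.simplePair s +
        sineRatio (M s t) (k + 1) • H.simplePair t := by
  induction k with
  | zero => simp [CoxeterSystem.alternatingWord, sineRatio]
  | succ k ih =>
    have hst := H.root_coroot s t
    have hts := H.root_coroot t s
    rw [M.symmetric t s] at hts
    rw [CoxeterSystem.alternatingWord_succ', cs.wordProd_cons, map_mul, Module.End.mul_apply, ih]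
    by_cases hk : Even k
    · rw [if_pos hk, if_pos hk, if_neg (by simpa [Nat.even_add_one] using hk), pairAct_simple,
        sineRatio]
      ext <;> simp [simplePair, root_coroot_self, hst, hts] <;> first | ring1 | module
    · rw [if_neg hk, if_neg hk, if_pos (by simpa [Nat.even_add_one] using hk), pairAct_simple,
        sineRatio]
      ext <;> simp [simplePair, root_coroot_self, hst, hts] <;> first | ring1 | module

/-- A group element that lengthens when multiplied by `s` on the right keeps `α_s` and `α_s^∨`
positive. The proof writes the element as a shorter one, lengthened by both `s` and `t`, times an
alternating word in `s` and `t`, where `t` is a right descent. -/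
theorem isPos_pairAct_simplePair (w : W) (s : I) (h : cs.length w < cs.length (w * cs.simple s)) :
    H.IsPos (H.pairAct cs w (H.simplePair s)) := by
  classical
  induction hn : cs.length w using Nat.strong_induction_on generalizing w s with
  | _ n ih =>
    by_cases hw : w = 1
    · subst hw
      rw [map_one]
      exact H.isPos_simplePair s
    obtain ⟨t, ht⟩ := cs.exists_rightDescent_of_ne_one hw
    have hts : s ≠ t := by
      rintro rfl
      exact absurd ht (not_lt.mpr h.le)
    let P : ℕ → Prop := fun k => ∃ v : W,
      w = v * cs.wordProd (CoxeterSystem.alternatingWord s t k) ∧ cs.length w = cs.length v + k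
    have hP1 : P 1 := by
      refine ⟨w * cs.simple t, ?_, ?_⟩
      · simp [CoxeterSystem.alternatingWord]
      · have := cs.length_mul_simple w t
        have : cs.length (w * cs.simple t) < cs.length w := ht
        omega
    have hPsucc : ∀ k, P (k + 1) → P k := by
      rintro k ⟨v, hv, hl⟩
      refine ⟨v * cs.simple (if Even k then t else s), ?_, ?_⟩
      · rw [hv, CoxeterSystem.alternatingWord_succ', cs.wordProd_cons, mul_assoc]
      · have h1 := cs.length_mul_simple v (if Even k then t else s)
        have h2 := cs.length_mul_le (v * cs.simple (if Even k then t else s))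
          (cs.wordProd (CoxeterSystem.alternatingWord s t k))
        have h3 := cs.length_wordProd_le (CoxeterSystem.alternatingWord s t k)
        rw [CoxeterSystem.length_alternatingWord] at h3
        rw [mul_assoc, ← cs.wordProd_cons, ← CoxeterSystem.alternatingWord_succ', ← hv] at h2
        omega
    have hbound : ∀ k, P k → k ≤ cs.length w := by
      rintro k ⟨v, _, hl⟩
      omega
    set k := Nat.findGreatest P (cs.length w) with hkdef
    have hPk : P k := Nat.findGreatest_spec (hbound 1 hP1) hP1
    have hk1 : 1 ≤ k := Nat.le_findGreatest (hbound 1 hP1) hP1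
    have hPk1 : ¬ P (k + 1) := fun hp =>
      absurd (Nat.le_findGreatest (hbound _ hp) hp) (by omega)
    -- An alternating word of length `m_st` may also be written with last letter `s`.
    have hkm : M s t ≠ 0 → k + 1 ≤ M s t := by
      intro hm
      by_contra hlt
      have hdown : ∀ j, j ≤ k → P (k - j) := by
        intro j
        induction j with
        | zero => exact fun _ => hPk
        | succ j ihj =>
          intro hj
          apply hPsucc
          have : k - (j + 1) + 1 = k - j := by omega
          rw [this]
          exact ihj (by omega)
      have hPm := hdown (k - M s t) (by omega)
      rw [Nat.sub_sub_self (by omega)] at hPm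
      obtain ⟨v, hv, hl⟩ := hPm
      have hb := cs.wordProd_braidWord_eq s t
      rw [CoxeterSystem.braidWord, CoxeterSystem.braidWord, M.symmetric t s] at hb
      rw [hb] at hv
      obtain ⟨m, hm'⟩ := Nat.exists_eq_succ_of_ne_zero hm
      rw [hm', Nat.succ_eq_add_one, CoxeterSystem.alternatingWord_succ, cs.wordProd_concat,
        ← mul_assoc] at hv
      have h4 : w * cs.simple s =
          v * cs.wordProd (CoxeterSystem.alternatingWord s t m) := by
        rw [hv, cs.simple_mul_simple_cancel_right]
      have h5 := cs.length_mul_le v (cs.wordProd (CoxeterSystem.alternatingWord s t m))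
      have h6 := cs.length_wordProd_le (CoxeterSystem.alternatingWord s t m)
      rw [CoxeterSystem.length_alternatingWord] at h6
      rw [← h4] at h5
      omega
    obtain ⟨v, hv, hl⟩ := hPk
    have hnext : cs.length v < cs.length (v * cs.simple (if Even k then t else s)) := by
      by_contra hle
      have h1 := cs.length_mul_simple v (if Even k then t else s)
      apply hPk1
      refine ⟨v * cs.simple (if Even k then t else s), ?_, by omega⟩
      rw [CoxeterSystem.alternatingWord_succ', cs.wordProd_cons, ← mul_assoc,
        cs.simple_mul_simple_cancel_right, hv]
    have hlast : cs.length v < cs.length (v * cs.simple (if Even k then s else t)) := by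
      obtain ⟨j, hj⟩ : ∃ j, k = j + 1 := ⟨k - 1, by omega⟩
      have hpar : (if Even k then s else t) = if Even j then t else s := by
        by_cases hj' : Even j <;> simp [hj, Nat.even_add_one, hj']
      have h2 := cs.length_mul_le (v * cs.simple (if Even j then t else s))
        (cs.wordProd (CoxeterSystem.alternatingWord s t j))
      have h3 := cs.length_wordProd_le (CoxeterSystem.alternatingWord s t j)
      rw [CoxeterSystem.length_alternatingWord] at h3
      rw [mul_assoc, ← cs.wordProd_cons, ← CoxeterSystem.alternatingWord_succ', ← hj, ← hv] at h2
      rw [hpar]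
      omega
    have hs : cs.length v < cs.length (v * cs.simple s) := by
      by_cases hk : Even k
      · rwa [if_pos hk] at hlast
      · rwa [if_neg hk] at hnext
    have ht : cs.length v < cs.length (v * cs.simple t) := by
      by_cases hk : Even k
      · rwa [if_pos hk] at hnext
      · rwa [if_neg hk] at hlast
    have hps := ih (cs.length v) (by omega) v s hs rfl
    have hpt := ih (cs.length v) (by omega) v t ht rfl
    have h0 : 0 ≤ sineRatio (M s t) k :=
      sineRatio_nonneg (M.off_diagonal s t hts) fun hm => by have := hkm hm; omega
    have h1 : 0 ≤ sineRatio (M s t) (k + 1) := sineRatio_nonneg (M.off_diagonal s t hts) hkm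
    rw [hv, map_mul, Module.End.mul_apply, pairAct_alternatingWord]
    split_ifs
    · rw [map_add, map_smul, map_smul]
      exact (hps.smul h1).add (hpt.smul h0)
    · rw [map_add, map_smul, map_smul]
      exact (hps.smul h0).add (hpt.smul h1)

theorem isPos_neg_pairAct_simplePair (w : W) (s : I)
    (h : cs.length (w * cs.simple s) < cs.length w) :
    H.IsPos (-H.pairAct cs w (H.simplePair s)) := by
  have h1 := isPos_pairAct_simplePair cs H (w * cs.simple s) s
    (by rwa [cs.simple_mul_simple_cancel_right])
  rwa [map_mul, Module.End.mul_apply, pairAct_simple_self, map_neg] at h1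

theorem simplePair_ne_zero (s : I) : H.simplePair s ≠ 0 := by
  intro h
  have := H.simplePair_pairing s
  simp [h] at this

/-- The action of `W` on `V*` is faithful. -/
theorem dualRep_injective : Function.Injective (H.dualRep cs) := by
  rw [injective_iff_map_eq_one]
  intro w hw
  by_contra hne
  obtain ⟨s, hs⟩ := cs.exists_rightDescent_of_ne_one hne
  obtain ⟨c, hc, hcw⟩ := isPos_neg_pairAct_simplePair cs H w s hs
  have h1 := congrArg Prod.fst hcw
  rw [Prod.fst_neg, pairAct_apply, hw, Module.End.one_apply, ← one_smul ℝ (H.simplePair s).1,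
    ← Prod.smul_fst, ← pairComb_single, pairComb_fst, pairComb_fst, ← map_neg] at h1
  have h2 := DFunLike.congr_fun (H.linearIndependent_root h1) s
  have h3 := hc s
  simp at h2
  linarith

/-- The pair of a root and its coroot. -/
def IsRootPair (γ : Dual ℝ V × V) : Prop :=
  ∃ (w : W) (s : I), γ = H.pairAct cs w (H.simplePair s)

variable {cs H} in
theorem IsRootPair.act {γ : Dual ℝ V × V} (h : H.IsRootPair cs γ) (w : W) :
    H.IsRootPair cs (H.pairAct cs w γ) := by
  obtain ⟨u, s, rfl⟩ := h
  exact ⟨w * u, s, by rw [map_mul, Module.End.mul_apply]⟩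

variable {cs H} in
theorem IsRootPair.ne_zero {γ : Dual ℝ V × V} (h : H.IsRootPair cs γ) : γ ≠ 0 := by
  obtain ⟨w, s, rfl⟩ := h
  intro h
  exact H.simplePair_ne_zero s (pairAct_injective cs H w (h.trans (map_zero _).symm))

variable {cs H} in
theorem IsRootPair.isPos_or {γ : Dual ℝ V × V} (h : H.IsRootPair cs γ) :
    H.IsPos γ ∨ H.IsPos (-γ) := by
  obtain ⟨w, s, rfl⟩ := h
  rcases lt_or_gt_of_ne (cs.length_mul_simple_ne w s) with h | h
  · exact Or.inr (isPos_neg_pairAct_simplePair cs H w s h)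
  · exact Or.inl (isPos_pairAct_simplePair cs H w s h)

/-- The only positive root that a simple reflection makes negative is the simple root. -/
theorem eq_simplePair {γ : Dual ℝ V × V} (hγ : H.IsRootPair cs γ) (h : H.IsPos γ) (s : I)
    (hs : H.IsPos (-H.pairAct cs (cs.simple s) γ)) : γ = H.simplePair s := by
  classical
  obtain ⟨c, hc, rfl⟩ := h
  obtain ⟨c', hc', h'⟩ := hs
  rw [pairAct_simple_comb, ← map_neg] at h'
  have h' := H.pairComb_injective h'
  have hcs : c = Finsupp.single s (c s) := by
    ext t
    by_cases hst : s = t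
    · subst hst; simp
    · have h1 := DFunLike.congr_fun h' t
      have h2 := hc t
      have h3 := hc' t
      simp [hst] at h1
      rw [Finsupp.single_apply, if_neg hst]
      linarith
  rw [hcs, pairComb_single] at hγ ⊢
  obtain ⟨w, t, hw⟩ := hγ
  have h2 : (c s • H.simplePair s).1 (c s • H.simplePair s).2 = 2 := by
    rw [hw, pairAct_pairing, simplePair_pairing]
  rw [Prod.smul_fst, Prod.smul_snd, map_smul, LinearMap.smul_apply, simplePair_pairing] at h2
  simp only [smul_eq_mul] at h2
  have : c s = 1 := by nlinarith [hc s]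
  rw [this, one_smul]

/-- A root and its coroot determine the reflection. -/
theorem reflection_eq_of_pairAct_eq {u u' : W} {s s' : I}
    (h : H.pairAct cs u (H.simplePair s) = H.pairAct cs u' (H.simplePair s')) :
    u * cs.simple s * u⁻¹ = u' * cs.simple s' * u'⁻¹ := by
  have key : ∀ (u : W) (s : I) (f : Dual ℝ V), H.dualRep cs (u * cs.simple s * u⁻¹) f =
      f - f (H.pairAct cs u (H.simplePair s)).2 • (H.pairAct cs u (H.simplePair s)).1 := by
    intro u s f
    rw [map_mul, map_mul, Module.End.mul_apply, Module.End.mul_apply, dualRep_simple, map_sub,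
      map_smul, ← Module.End.mul_apply, ← map_mul, mul_inv_cancel, map_one, dualRep_apply, inv_inv]
    rfl
  apply dualRep_injective cs H
  ext1 f
  rw [key, key, h]

/-- The inversion roots `s_m ⋯ s_{j+1} α_j` of a word `s₁ ⋯ s_m`, with their coroots, each
together with the word with the letter `s_j` left out. -/
def inversions : List I → List ((Dual ℝ V × V) × List I)
  | [] => []
  | s :: ω => (H.pairAct cs (cs.wordProd ω)⁻¹ (H.simplePair s), ω) ::
      (inversions ω).map fun p => (p.1, s :: p.2)

theorem exists_of_mem_inversions {ω : List I} {p : (Dual ℝ V × V) × List I}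
    (hp : p ∈ H.inversions cs ω) : p.2.length + 1 = ω.length ∧
      ∃ (u : W) (s : I), p.1 = H.pairAct cs u (H.simplePair s) ∧
        cs.wordProd p.2 = cs.wordProd ω * (u * cs.simple s * u⁻¹) := by
  induction ω generalizing p with
  | nil => simp [inversions] at hp
  | cons s ω ih =>
    rw [inversions, List.mem_cons, List.mem_map] at hp
    rcases hp with rfl | ⟨q, hq, rfl⟩
    · refine ⟨rfl, (cs.wordProd ω)⁻¹, s, rfl, ?_⟩
      rw [cs.wordProd_cons]
      simp [mul_assoc]
    · obtain ⟨hl, u, t, h1, h2⟩ := ih hq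
      refine ⟨by simp [hl], u, t, h1, ?_⟩
      rw [cs.wordProd_cons, cs.wordProd_cons, h2]
      simp only [mul_assoc]

/-- For a reduced word of `y`, the inversion roots are distinct, and they are the positive roots
`γ` such that `y γ` is negative. -/
theorem nodup_inversions {ω : List I} (hω : cs.IsReduced ω) :
    ((H.inversions cs ω).map Prod.fst).Nodup ∧
      ∀ γ, γ ∈ (H.inversions cs ω).map Prod.fst ↔ H.IsRootPair cs γ ∧ H.IsPos γ ∧
        H.IsPos (-H.pairAct cs (cs.wordProd ω) γ) := by
  induction ω with
  | nil =>
    refine ⟨List.nodup_nil, fun γ => ⟨fun h => by simp [inversions] at h, ?_⟩⟩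
    rintro ⟨h1, h2, h3⟩
    rw [cs.wordProd_nil, map_one] at h3
    exact absurd (h2.eq_zero_of_neg h3) h1.ne_zero
  | cons s ω ih =>
    have hω' : cs.IsReduced ω := hω.drop 1
    obtain ⟨ih1, ih2⟩ := ih hω'
    set y := cs.wordProd ω with hy
    have hpos : H.IsPos (H.pairAct cs y⁻¹ (H.simplePair s)) := by
      apply isPos_pairAct_simplePair
      have h1 : cs.length (cs.simple s * y) = ω.length + 1 := by
        rw [hy, ← cs.wordProd_cons]; exact hω
      have h2 : cs.length y = ω.length := hω'
      have h3 := cs.length_inv (cs.simple s * y)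
      rw [mul_inv_rev, cs.inv_simple] at h3
      rw [cs.length_inv, h3]
      omega
    have hlist : (H.inversions cs (s :: ω)).map Prod.fst =
        H.pairAct cs y⁻¹ (H.simplePair s) :: (H.inversions cs ω).map Prod.fst := by
      simp [inversions, List.map_map, Function.comp_def, hy]
    have hroot : H.IsRootPair cs (H.pairAct cs y⁻¹ (H.simplePair s)) := ⟨_, _, rfl⟩
    rw [hlist, List.nodup_cons]
    refine ⟨⟨fun hmem => ?_, ih1⟩, fun γ => ?_⟩
    · obtain ⟨-, -, h⟩ := (ih2 _).1 hmem
      rw [pairAct_cancel_inv] at h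
      exact H.simplePair_ne_zero s ((H.isPos_simplePair s).eq_zero_of_neg h)
    · rw [List.mem_cons, ih2, cs.wordProd_cons, ← hy, map_mul, Module.End.mul_apply]
      constructor
      · rintro (rfl | ⟨h1, h2, h3⟩)
        · refine ⟨hroot, hpos, ?_⟩
          rw [pairAct_cancel_inv, pairAct_simple_self, neg_neg]
          exact H.isPos_simplePair s
        · refine ⟨h1, h2, ?_⟩
          rcases ((h1.act y).act (cs.simple s)).isPos_or with h | h
          · exfalso
            have hneg : H.IsRootPair cs (-H.pairAct cs y γ) := by
              obtain ⟨u, t, hu⟩ := h1.act y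
              refine ⟨u * cs.simple t, t, ?_⟩
              rw [map_mul, Module.End.mul_apply, pairAct_simple_self, map_neg, hu]
            have e := eq_simplePair cs H hneg h3 s (by rwa [map_neg, neg_neg])
            have e2 : γ = -H.pairAct cs y⁻¹ (H.simplePair s) := by
              rw [← e, map_neg, neg_neg, pairAct_inv_cancel]
            exact h1.ne_zero (h2.eq_zero_of_neg (by rwa [e2, neg_neg]))
          · exact h
      · rintro ⟨h1, h2, h3⟩
        rcases (h1.act y).isPos_or with h | h
        · left
          rw [← eq_simplePair cs H (h1.act y) h s h3, pairAct_inv_cancel]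
        · exact Or.inr ⟨h1, h2, h⟩

end roots
end Realisation
/-! ### The nil Hecke algebra -/

section nilHecke
variable {I W V : Type*} [Group W] {M : CoxeterMatrix I} [AddCommGroup V] [Module ℝ V]

theorem ι_injective : Function.Injective (SymmetricAlgebra.ι ℝ (Dual ℝ V)) := by
  intro f g h
  ext v
  have := congrArg (SymmetricAlgebra.lift
    (LinearMap.toSpanSingleton ℝ ℝ 1 ∘ₗ (Dual.eval ℝ V v))) h
  simpa using this

variable (cs : CoxeterSystem M W) (H : Realisation M V)

theorem rootMonoid_le_nonZeroDivisors : rootMonoid cs H ≤ nonZeroDivisors (PolyRing V) := by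
  rw [rootMonoid, Submonoid.closure_le]
  rintro _ ⟨_, ⟨w, s, rfl⟩, rfl⟩
  rw [SetLike.mem_coe, mem_nonZeroDivisors_iff_ne_zero, ← polyAct_ι]
  intro h
  apply root_ne_zero H s
  have h2 := congrArg (polyAct cs H w⁻¹) h
  rwa [map_zero, ← AlgHom.mul_apply, ← map_mul, inv_mul_cancel, map_one, AlgHom.one_apply] at h2

instance : IsDomain (RootLoc cs H) :=
  IsLocalization.isDomain_of_le_nonZeroDivisors _ (rootMonoid_le_nonZeroDivisors cs H)

theorem algebraMap_rootLoc_injective :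
    Function.Injective (algebraMap (PolyRing V) (RootLoc cs H)) :=
  IsLocalization.injective _ (rootMonoid_le_nonZeroDivisors cs H)

theorem smul_algebraMap (w : W) (f : PolyRing V) :
    w • algebraMap (PolyRing V) (RootLoc cs H) f = algebraMap _ _ (polyAct cs H w f) :=
  locAct_algebraMap cs H w f

theorem invRoot_mul_root (s : I) :
    invRoot cs H s * algebraMap _ _ (SymmetricAlgebra.ι ℝ _ (H.root s)) = 1 :=
  (IsLocalization.mk'_spec (RootLoc cs H) 1 _).trans (map_one _)

theorem smul_invRoot (s : I) : cs.simple s • invRoot cs H s = -invRoot cs H s := by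
  have h := congrArg (cs.simple s • ·) (invRoot_mul_root cs H s)
  have h2 := invRoot_mul_root cs H s
  simp only [smul_mul', smul_algebraMap, act_root, map_neg, smul_one] at h
  linear_combination (-invRoot cs H s) * h + (-(cs.simple s • invRoot cs H s)) * h2

theorem exists_polyAct_ne {x y : W} (h : x ≠ y) :
    ∃ f : Dual ℝ V, polyAct cs H x (SymmetricAlgebra.ι ℝ _ f) ≠
      polyAct cs H y (SymmetricAlgebra.ι ℝ _ f) := by
  by_contra! hc
  apply h
  apply H.dualRep_injective cs
  ext1 f
  have := hc f
  rw [polyAct_ι, polyAct_ι] at this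
  exact ι_injective this

/-- The inclusion of `R` in the smash product. -/
noncomputable def polyEmb : PolyRing V →+* SmashProduct cs H :=
  SkewMonoidAlgebra.singleOneRingHom.comp (algebraMap (PolyRing V) (RootLoc cs H))

theorem polyEmb_apply (f : PolyRing V) :
    polyEmb cs H f = SkewMonoidAlgebra.single 1 (algebraMap _ _ f) := rfl

theorem polyEmb_algebraMap_commute (r : ℝ) (X : SmashProduct cs H) :
    Commute (polyEmb cs H (algebraMap ℝ _ r)) X := by
  apply SkewMonoidAlgebra.ext
  intro x
  rw [polyEmb_apply, SkewMonoidAlgebra.coeff_single_one_mul,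
    SkewMonoidAlgebra.coeff_mul_single_one, smul_algebraMap, AlgHom.commutes, mul_comm]

theorem nilD_eq (s : I) : nilD cs H s = SkewMonoidAlgebra.single 1 (invRoot cs H s) -
    SkewMonoidAlgebra.single (cs.simple s) (invRoot cs H s) := by
  simp [nilD, mul_sub]

theorem nilD_mul_self (s : I) : nilD cs H s * nilD cs H s = 0 := by
  simp only [nilD_eq, mul_sub, sub_mul, SkewMonoidAlgebra.single_mul_single, one_mul, mul_one,
    one_smul, smul_invRoot, cs.simple_mul_simple_self, mul_neg, SkewMonoidAlgebra.single_neg]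
  abel

/-- The twisted Leibniz rule `D_s f = s(f) D_s + ∂_s(f)`. -/
theorem nilD_mul_polyEmb (s : I) (f : PolyRing V) : nilD cs H s * polyEmb cs H f =
    polyEmb cs H (polyAct cs H (cs.simple s) f) * nilD cs H s +
      polyEmb cs H (demazure cs H s f) := by
  have h1 := congrArg (algebraMap (PolyRing V) (RootLoc cs H)) (root_mul_demazure cs H s f)
  rw [map_mul, map_sub] at h1
  have h2 := invRoot_mul_root cs H s
  simp only [nilD_eq, polyEmb_apply, mul_sub, sub_mul, SkewMonoidAlgebra.single_mul_single,
    one_mul, mul_one, one_smul, smul_algebraMap]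
  have h3 : algebraMap (PolyRing V) (RootLoc cs H) (demazure cs H s f) =
      invRoot cs H s * algebraMap _ _ f -
        algebraMap _ _ (polyAct cs H (cs.simple s) f) * invRoot cs H s := by
    linear_combination (-algebraMap (PolyRing V) (RootLoc cs H) (demazure cs H s f)) * h2 +
      invRoot cs H s * h1
  rw [h3, sub_eq_add_neg (invRoot cs H s * _), SkewMonoidAlgebra.single_add,
    SkewMonoidAlgebra.single_neg, mul_comm (algebraMap (PolyRing V) (RootLoc cs H)
      (polyAct cs H (cs.simple s) f)) (invRoot cs H s)]
  abel

theorem nilDWord_cons (s : I) (ω : List I) :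
    nilDWord cs H (s :: ω) = nilD cs H s * nilDWord cs H ω := by
  simp [nilDWord]

/-- The Leibniz rule for the product of the `D_s` along a word, applied to a linear form. The
correction terms belong to the inversion roots of the word. -/
theorem nilDWord_mul_polyEmb_ι (ω : List I) (f : Dual ℝ V) :
    nilDWord cs H ω * polyEmb cs H (SymmetricAlgebra.ι ℝ _ f) =
      polyEmb cs H (SymmetricAlgebra.ι ℝ _ (H.dualRep cs (cs.wordProd ω) f)) * nilDWord cs H ω +
        ((H.inversions cs ω).map fun p =>
          polyEmb cs H (algebraMap ℝ _ (f p.1.2)) * nilDWord cs H p.2).sum := by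
  induction ω with
  | nil => simp [nilDWord, Realisation.inversions]
  | cons s ω ih =>
    have hd : (H.dualRep cs (cs.wordProd ω) f) (H.coroot s) =
        f (H.pairAct cs (cs.wordProd ω)⁻¹ (H.simplePair s)).2 := rfl
    have hs : nilD cs H s * ((H.inversions cs ω).map fun p =>
          polyEmb cs H (algebraMap ℝ _ (f p.1.2)) * nilDWord cs H p.2).sum =
        ((H.inversions cs ω).map fun p =>
          polyEmb cs H (algebraMap ℝ _ (f p.1.2)) * nilDWord cs H (s :: p.2)).sum := by
      rw [← List.sum_map_mul_left]
      congr 1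
      apply List.map_congr_left
      intro p _
      rw [nilDWord_cons, ← mul_assoc, ← mul_assoc, (polyEmb_algebraMap_commute cs H _ _).eq]
    rw [nilDWord_cons, mul_assoc, ih, mul_add, hs, ← mul_assoc, nilD_mul_polyEmb, polyAct_ι,
      demazure_ι, hd, cs.wordProd_cons, map_mul, Module.End.mul_apply, Realisation.inversions,
      List.map_cons, List.sum_cons, List.map_map, add_mul, mul_assoc, Function.comp_def]
    abel

/-- The sum of the coefficients of an element of the smash product. -/
noncomputable def augmentation : SmashProduct cs H →+ RootLoc cs H :=
  SkewMonoidAlgebra.liftNC (AddMonoidHom.id _) fun _ => 1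

theorem augmentation_single (x : W) (q : RootLoc cs H) :
    augmentation cs H (SkewMonoidAlgebra.single x q) = q := by
  simp [augmentation]

theorem augmentation_mul_nilD (X : SmashProduct cs H) (s : I) :
    augmentation cs H (X * nilD cs H s) = 0 := by
  induction X using SkewMonoidAlgebra.induction_on with
  | zero => simp
  | single x q =>
    rw [nilD_eq, mul_sub, map_sub, SkewMonoidAlgebra.single_mul_single,
      SkewMonoidAlgebra.single_mul_single, augmentation_single, augmentation_single, sub_self]
  | add X Y hX hY => rw [add_mul, map_add, hX, hY, add_zero]

theorem augmentation_nilDWord {ω : List I} (hω : ω ≠ []) :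
    augmentation cs H (nilDWord cs H ω) = 0 := by
  rcases List.eq_nil_or_concat ω with rfl | ⟨τ, s, rfl⟩
  · exact absurd rfl hω
  · rw [nilDWord, List.concat_eq_append, List.map_append, List.prod_append, List.map_singleton,
      List.prod_singleton]
    exact augmentation_mul_nilD cs H _ s

/-- The elements of the smash product that commute with linear forms up to the twist by `y` are
the multiples of `δ_y`. -/
theorem coeff_eq_zero_of_twisted_commute {X : SmashProduct cs H} {y : W}
    (h : ∀ f : Dual ℝ V, X * polyEmb cs H (SymmetricAlgebra.ι ℝ _ f) =
      polyEmb cs H (SymmetricAlgebra.ι ℝ _ (H.dualRep cs y f)) * X) {x : W} (hx : x ≠ y) :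
    X.coeff x = 0 := by
  obtain ⟨f, hf⟩ := exists_polyAct_ne cs H hx
  have h1 := congrArg (fun Z : SmashProduct cs H => Z.coeff x) (h f)
  simp only [polyEmb_apply, SkewMonoidAlgebra.coeff_single_one_mul,
    SkewMonoidAlgebra.coeff_mul_single_one, smul_algebraMap, ← polyAct_ι] at h1
  rw [mul_comm, ← sub_eq_zero, ← sub_mul, mul_eq_zero] at h1
  refine h1.resolve_left fun h2 => hf ?_
  exact algebraMap_rootLoc_injective cs H (sub_eq_zero.mp h2)

theorem exists_isReduced_cons {s : I} {τ : List I} (hτ : cs.IsReduced τ)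
    (h : ¬ cs.IsReduced (s :: τ)) : ∃ ρ : List I, cs.IsReduced (s :: ρ) ∧
      cs.wordProd (s :: ρ) = cs.wordProd τ := by
  obtain ⟨ρ, hρ, hρs⟩ := cs.exists_isReduced (cs.simple s * cs.wordProd τ)
  have h1 := cs.length_simple_mul (cs.wordProd τ) s
  have h2 : cs.length (cs.wordProd τ) = τ.length := hτ
  have h3 : cs.length (cs.wordProd ρ) = ρ.length := hρ
  have h4 : cs.wordProd (s :: ρ) = cs.wordProd τ := by
    rw [cs.wordProd_cons, ← hρs, cs.simple_mul_simple_cancel_left]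
  have h5 : cs.length (cs.simple s * cs.wordProd τ) ≠ τ.length + 1 := by
    rw [← cs.wordProd_cons]
    exact h
  rw [hρs] at h1 h5
  have h6 : (s :: ρ).length = τ.length := by
    rw [List.length_cons]
    omega
  refine ⟨ρ, ?_, h4⟩
  rw [CoxeterSystem.IsReduced, h4, h2, h6]

/-- The product of the `D_s` along a word vanishes if the word is not reduced, and depends only on
the group element if it is reduced. Both parts go by induction on the length. For two reduced words
of `y` the Leibniz rules have the same correction terms, because the inversion roots are determined
by `y`; so the difference `Δ` of the two products satisfies `Δ f = y(f) Δ` and is a multiple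
of `δ_y`. Since its augmentation is zero, it vanishes. -/
theorem nilDWord_well_defined (n : ℕ) :
    (∀ ω : List I, ω.length = n → ¬ cs.IsReduced ω → nilDWord cs H ω = 0) ∧
    ∀ ω η : List I, ω.length = n → cs.IsReduced ω → cs.IsReduced η →
      cs.wordProd ω = cs.wordProd η → nilDWord cs H ω = nilDWord cs H η := by
  classical
  induction n with
  | zero =>
    refine ⟨fun ω hω h => ?_, fun ω η hω h h' he => ?_⟩
    · rw [List.length_eq_zero_iff] at hω
      subst hω
      exact absurd (by simp [CoxeterSystem.IsReduced]) h
    · have h1 : ω.length = η.length := by rw [← h.eq, ← h'.eq, he]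
      rw [List.length_eq_zero_iff] at hω
      subst hω
      rw [List.length_nil, eq_comm, List.length_eq_zero_iff] at h1
      rw [h1]
  | succ n ih =>
    obtain ⟨ihz, ihe⟩ := ih
    have hz : ∀ ω : List I, ω.length = n + 1 → ¬ cs.IsReduced ω → nilDWord cs H ω = 0 := by
      intro ω hω h
      match ω, hω with
      | s :: τ, hω =>
        have hτn : τ.length = n := by simpa using hω
        rw [nilDWord_cons]
        by_cases hτ : cs.IsReduced τ
        · obtain ⟨ρ, hρ, hρτ⟩ := exists_isReduced_cons cs hτ h
          rw [ihe τ (s :: ρ) hτn hτ hρ hρτ.symm, nilDWord_cons, ← mul_assoc, nilD_mul_self,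
            zero_mul]
        · rw [ihz τ hτn hτ, mul_zero]
    refine ⟨hz, fun ω η hωn hω hη he => ?_⟩
    have hηn : η.length = n + 1 := by rw [← hη.eq, ← he, hω.eq, hωn]
    have ih' : ∀ τ τ' : List I, τ.length = n → τ'.length = n →
        cs.wordProd τ = cs.wordProd τ' → nilDWord cs H τ = nilDWord cs H τ' := by
      intro τ τ' hτ hτ' h
      have hiff : cs.IsReduced τ ↔ cs.IsReduced τ' := by
        rw [CoxeterSystem.IsReduced, CoxeterSystem.IsReduced, h, hτ, hτ']
      by_cases hr : cs.IsReduced τ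
      · exact ihe τ τ' hτ hr (hiff.1 hr) h
      · rw [ihz τ hτ hr, ihz τ' hτ' fun h => hr (hiff.2 h)]
    -- The correction terms as a function of the inversion root alone.
    have hterm : ∀ (p p' : (Dual ℝ V × V) × List I), p ∈ H.inversions cs ω ++ H.inversions cs η →
        p' ∈ H.inversions cs ω ++ H.inversions cs η → p.1 = p'.1 →
        nilDWord cs H p.2 = nilDWord cs H p'.2 := by
      have hex : ∀ p ∈ H.inversions cs ω ++ H.inversions cs η, p.2.length = n ∧
          ∃ (u : W) (s : I), p.1 = H.pairAct cs u (H.simplePair s) ∧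
            cs.wordProd p.2 = cs.wordProd ω * (u * cs.simple s * u⁻¹) := by
        intro p hp
        rcases List.mem_append.1 hp with hp | hp
        · obtain ⟨h1, h2⟩ := H.exists_of_mem_inversions cs hp
          exact ⟨by omega, h2⟩
        · obtain ⟨h1, h2⟩ := H.exists_of_mem_inversions cs hp
          rw [← he] at h2
          exact ⟨by omega, h2⟩
      intro p p' hp hp' hpp
      obtain ⟨hl, u, s, h1, h2⟩ := hex p hp
      obtain ⟨hl', u', s', h1', h2'⟩ := hex p' hp'
      apply ih' _ _ hl hl'
      rw [h2, h2', H.reflection_eq_of_pairAct_eq cs (h1.symm.trans (hpp.trans h1'))]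
    let G : Dual ℝ V × V → SmashProduct cs H := fun γ =>
      if h : ∃ p ∈ H.inversions cs ω ++ H.inversions cs η, p.1 = γ then nilDWord cs H h.choose.2
      else 0
    have hG : ∀ p ∈ H.inversions cs ω ++ H.inversions cs η, nilDWord cs H p.2 = G p.1 := by
      intro p hp
      have hex : ∃ p' ∈ H.inversions cs ω ++ H.inversions cs η, p'.1 = p.1 := ⟨p, hp, rfl⟩
      simp only [G, dif_pos hex]
      exact hterm _ _ hp hex.choose_spec.1 hex.choose_spec.2.symm
    have hperm : ((H.inversions cs ω).map Prod.fst).Perm ((H.inversions cs η).map Prod.fst) := by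
      obtain ⟨h1, h2⟩ := H.nodup_inversions cs hω
      obtain ⟨h3, h4⟩ := H.nodup_inversions cs hη
      rw [List.perm_ext_iff_of_nodup h1 h3]
      intro γ
      rw [h2, h4, he]
    have hsum : ∀ f : Dual ℝ V,
        ((H.inversions cs ω).map fun p =>
          polyEmb cs H (algebraMap ℝ _ (f p.1.2)) * nilDWord cs H p.2).sum =
        ((H.inversions cs η).map fun p =>
          polyEmb cs H (algebraMap ℝ _ (f p.1.2)) * nilDWord cs H p.2).sum := by
      intro f
      have hmap : ∀ L : List ((Dual ℝ V × V) × List I),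
          (∀ p ∈ L, p ∈ H.inversions cs ω ++ H.inversions cs η) →
          (L.map fun p => polyEmb cs H (algebraMap ℝ _ (f p.1.2)) * nilDWord cs H p.2) =
            (L.map Prod.fst).map fun γ => polyEmb cs H (algebraMap ℝ _ (f γ.2)) * G γ := by
        intro L hL
        rw [List.map_map]
        apply List.map_congr_left
        intro p hp
        rw [hG p (hL p hp)]
        rfl
      rw [hmap _ fun p hp => List.mem_append.2 (Or.inl hp),
        hmap _ fun p hp => List.mem_append.2 (Or.inr hp)]
      exact (hperm.map _).sum_eq
    rw [← sub_eq_zero]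
    set Δ := nilDWord cs H ω - nilDWord cs H η with hΔ
    have hcomm : ∀ f : Dual ℝ V, Δ * polyEmb cs H (SymmetricAlgebra.ι ℝ _ f) =
        polyEmb cs H (SymmetricAlgebra.ι ℝ _ (H.dualRep cs (cs.wordProd ω) f)) * Δ := by
      intro f
      rw [hΔ, sub_mul, nilDWord_mul_polyEmb_ι, nilDWord_mul_polyEmb_ι, hsum, ← he, mul_sub]
      abel
    have hsingle : Δ = SkewMonoidAlgebra.single (cs.wordProd ω) (Δ.coeff (cs.wordProd ω)) := by
      apply SkewMonoidAlgebra.ext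
      intro x
      rw [SkewMonoidAlgebra.coeff_single_apply]
      split_ifs with hx
      · rw [hx]
      · exact coeff_eq_zero_of_twisted_commute cs H hcomm (Ne.symm hx)
    have haug : augmentation cs H Δ = 0 := by
      rw [hΔ, map_sub, augmentation_nilDWord cs H (by rintro rfl; simp at hωn),
        augmentation_nilDWord cs H (by rintro rfl; simp at hηn), sub_zero]
    rw [hsingle, augmentation_single] at haug
    rw [hsingle, haug, SkewMonoidAlgebra.single_zero]

/-- The equivariant multiplicities do not depend on the reduced word. -/
theorem equivMult_eq {ω η : List I} (hω : cs.IsReduced ω) (hη : cs.IsReduced η)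
    (h : cs.wordProd ω = cs.wordProd η) (x : W) : equivMult cs H x ω = equivMult cs H x η := by
  rw [equivMult, equivMult, (nilDWord_well_defined cs H _).2 ω η rfl hω hη h]

end nilHecke
/-! ### Localisation of Bott-Samelson bimodules -/

section fixedPoints
universe u
variable {I W : Type*} {V : Type u} [Group W] {M : CoxeterMatrix I} [AddCommGroup V] [Module ℝ V]

/-- Localisation data of a Bott-Samelson bimodule: ring homomorphisms to `R`, labelled by the
subexpressions of the word, that together are injective. Left multiplication by `f` corresponds to
multiplication by `f` and right multiplication to multiplication by `w(f)`, where `w` is the product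
of the subexpression. The trace is a sum over these homomorphisms, with coefficients in `Q`. -/
structure FixedPoints (cs : CoxeterSystem M W) (H : Realisation M V) (C : BSData V) where
  Idx : Type
  [fintype : Fintype Idx]
  elt : Idx → W
  coeff : Idx → RootLoc cs H
  ev : Idx → C.carrier →+* PolyRing V
  ev_left : ∀ e f, ev e (C.left f) = f
  ev_right : ∀ e f, ev e (C.right f) = polyAct cs H (elt e) f
  trace_eq : ∀ b, algebraMap (PolyRing V) (RootLoc cs H) (C.trace b) =
    ∑ e, coeff e * algebraMap _ _ (ev e b)
  eq_zero : ∀ b, (∀ e, ev e b = 0) → b = 0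

attribute [instance] FixedPoints.fintype

variable (cs : CoxeterSystem M W) (H : Realisation M V)

/-- The empty word has a single subexpression. -/
noncomputable def FixedPoints.unit : FixedPoints cs H (BSData.unit V) where
  Idx := Unit
  elt _ := 1
  coeff _ := 1
  ev _ := RingHom.id _
  ev_left _ _ := rfl
  ev_right _ f := by rw [map_one]; rfl
  trace_eq b := by
    rw [Fintype.sum_unique, one_mul]
    rfl
  eq_zero b h := h ()

variable {cs H} {C : BSData V}

/-- The ring homomorphism `g ⊗ b ↦ g w(φ b)` on `R ⊗_{R^s} C`, where `w ∈ {1, s}`. -/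
noncomputable def stepEv (s : I) (φ : C.carrier →+* PolyRing V) (hφ : ∀ f, φ (C.left f) = f)
    (w : W) (hw : ∀ f, polyAct cs H (cs.simple s) f = f → polyAct cs H w f = f) :
    Induced cs H s C →+* PolyRing V :=
  (Algebra.TensorProduct.productMap (R := invariants cs H s) (A := PolyRing V)
    (B := Restrict cs H s C) (AlgHom.id _ _)
    { toRingHom := (polyAct cs H w).toRingHom.comp φ
      commutes' := fun a => by
        have h : φ (C.left a.1) = a.1 := hφ _
        change polyAct cs H w (φ (C.left a.1)) = a.1
        rw [h]
        exact hw _ a.2 }).toRingHom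

theorem stepEv_tmk (s : I) (φ : C.carrier →+* PolyRing V) (hφ : ∀ f, φ (C.left f) = f)
    (w : W) (hw : ∀ f, polyAct cs H (cs.simple s) f = f → polyAct cs H w f = f)
    (f : PolyRing V) (b : C.carrier) :
    stepEv s φ hφ w hw (tmk cs H s f b) = f * polyAct cs H w (φ b) :=
  Algebra.TensorProduct.productMap_apply_tmul _ _ _ _

variable (s : I) (L : FixedPoints cs H C) (e : L.Idx)

/-- The extension of a homomorphism `C → R` to `R ⊗_{R^s} C` with `1` chosen from `{1, s}`. -/
noncomputable def FixedPoints.evOmit : Induced cs H s C →+* PolyRing V :=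
  stepEv s (L.ev e) (L.ev_left e) 1 fun f _ => by rw [map_one, AlgHom.one_apply]

/-- The extension of a homomorphism `C → R` to `R ⊗_{R^s} C` with `s` chosen from `{1, s}`. -/
noncomputable def FixedPoints.evTake : Induced cs H s C →+* PolyRing V :=
  stepEv s (L.ev e) (L.ev_left e) (cs.simple s) fun _ h => h

theorem FixedPoints.evOmit_tmk (f : PolyRing V) (b : C.carrier) :
    L.evOmit s e (tmk cs H s f b) = f * L.ev e b := by
  rw [evOmit, stepEv_tmk, map_one, AlgHom.one_apply]

theorem FixedPoints.evTake_tmk (f : PolyRing V) (b : C.carrier) :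
    L.evTake s e (tmk cs H s f b) = f * polyAct cs H (cs.simple s) (L.ev e b) := by
  rw [evTake, stepEv_tmk]

theorem FixedPoints.stepTrace_eq (z : Induced cs H s C) :
    algebraMap (PolyRing V) (RootLoc cs H) (stepTrace cs H s z) =
      ∑ e, invRoot cs H s * L.coeff e * algebraMap _ _ (L.evOmit s e z) +
        ∑ e, -invRoot cs H s * cs.simple s • L.coeff e * algebraMap _ _ (L.evTake s e z) := by
  induction z using induced_induction with
  | h0 => simp only [map_zero, mul_zero, Finset.sum_const_zero, add_zero]
  | ha x y hx hy =>
    simp only [map_add, mul_add, Finset.sum_add_distrib, hx, hy]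
    abel
  | ht f b =>
    simp only [evOmit_tmk, evTake_tmk, stepTrace_tmk, map_mul]
    have h1 := congrArg (algebraMap (PolyRing V) (RootLoc cs H))
      (root_mul_demazure cs H s (C.trace b))
    have h2 := invRoot_mul_root cs H s
    have h3 := congrArg (cs.simple s • ·) (L.trace_eq b)
    simp only [smul_algebraMap, Finset.smul_sum, smul_mul'] at h3
    rw [map_mul, map_sub, h3, L.trace_eq] at h1
    have e1 : ∑ e, invRoot cs H s * L.coeff e * (algebraMap (PolyRing V) (RootLoc cs H) f *
        algebraMap _ _ (L.ev e b)) = invRoot cs H s * algebraMap _ _ f *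
          ∑ e, L.coeff e * algebraMap _ _ (L.ev e b) := by
      rw [Finset.mul_sum]
      exact Finset.sum_congr rfl fun e _ => by ring
    have e2 : ∑ e, -invRoot cs H s * cs.simple s • L.coeff e *
        (algebraMap (PolyRing V) (RootLoc cs H) f *
        algebraMap _ _ (polyAct cs H (cs.simple s) (L.ev e b))) =
          -(invRoot cs H s * algebraMap _ _ f *
          ∑ e, cs.simple s • L.coeff e *
            algebraMap _ _ (polyAct cs H (cs.simple s) (L.ev e b))) := by
      rw [Finset.mul_sum, ← Finset.sum_neg_distrib]
      exact Finset.sum_congr rfl fun e _ => by ring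
    rw [e1, e2]
    linear_combination (-algebraMap (PolyRing V) (RootLoc cs H) f *
      algebraMap _ _ (demazure cs H s (C.trace b))) * h2 +
      invRoot cs H s * algebraMap _ _ f * h1

theorem FixedPoints.step_eq_zero (z : Induced cs H s C)
    (h : ∀ e, L.evOmit s e z = 0 ∧ L.evTake s e z = 0) : z = 0 := by
  have hz := eq_proj cs H s z
  have h2R : (2 : PolyRing V) ≠ 0 := by
    have h2 := (map_ne_zero (algebraMap ℝ (PolyRing V))).2 (two_ne_zero (α := ℝ))
    rwa [map_ofNat] at h2
  have key : ∀ e, L.ev e (projSym cs H s z) = 0 ∧ L.ev e (projAnti cs H s z) = 0 := by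
    intro e
    obtain ⟨h1, h2⟩ := h e
    rw [hz, map_add, evOmit_tmk, evOmit_tmk, one_mul] at h1
    rw [hz, map_add, evTake_tmk, evTake_tmk, one_mul] at h2
    have h3 := congrArg (polyAct cs H (cs.simple s)) h2
    rw [map_add, map_mul, act_act, act_act, act_root, map_zero] at h3
    constructor
    · have : (2 : PolyRing V) * L.ev e (projSym cs H s z) = 0 := by linear_combination h1 + h3
      exact (mul_eq_zero.mp this).resolve_left h2R
    · have : SymmetricAlgebra.ι ℝ _ (H.root s) *
          ((2 : PolyRing V) * L.ev e (projAnti cs H s z)) = 0 := by linear_combination h1 - h3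
      exact (mul_eq_zero.mp ((mul_eq_zero.mp this).resolve_left
        (root_ne_zero H s))).resolve_left h2R
  rw [hz, L.eq_zero _ fun e => (key e).1, L.eq_zero _ fun e => (key e).2, tmk_zero, tmk_zero,
    add_zero]

/-- A subexpression of `s ω` consists of a choice for `s` and a subexpression of `ω`. The two choices
correspond to the two terms of `D_s = (1 / α_s) δ_id - (1 / α_s) δ_s`. -/
noncomputable def FixedPoints.step : FixedPoints cs H (BSData.step cs H s C) where
  Idx := L.Idx ⊕ L.Idx
  elt := Sum.elim L.elt fun e => cs.simple s * L.elt e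
  coeff := Sum.elim (fun e => invRoot cs H s * L.coeff e)
    fun e => -invRoot cs H s * cs.simple s • L.coeff e
  ev := Sum.elim (L.evOmit s) (L.evTake s)
  ev_left e f := by
    rcases e with e | e
    · refine (L.evOmit_tmk s e f 1).trans ?_
      rw [map_one, mul_one]
    · refine (L.evTake_tmk s e f 1).trans ?_
      rw [map_one, map_one, mul_one]
  ev_right e f := by
    rcases e with e | e
    · refine (L.evOmit_tmk s e 1 (C.right f)).trans ?_
      rw [one_mul, L.ev_right]
      rfl
    · refine (L.evTake_tmk s e 1 (C.right f)).trans ?_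
      rw [one_mul, L.ev_right, Sum.elim_inr, map_mul, AlgHom.mul_apply]
  trace_eq z := by
    refine (L.stepTrace_eq s z).trans ?_
    symm
    exact Fintype.sum_sum_type _
  eq_zero z h := L.step_eq_zero s z fun e => ⟨h (Sum.inl e), h (Sum.inr e)⟩

variable (cs H) in
/-- The localisation data of `B(ω)`. -/
noncomputable def bsFixedPoints : (ω : List I) → FixedPoints cs H (bsData cs H ω)
  | [] => FixedPoints.unit cs H
  | s :: ω => FixedPoints.step s (bsFixedPoints ω)

variable (cs H) in
/-- The coefficients in the trace form are those of the subexpressions in `D_{s₁} ⋯ D_{s_m}`. -/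
theorem sum_single_bsFixedPoints (ω : List I) :
    ∑ e, SkewMonoidAlgebra.single ((bsFixedPoints cs H ω).elt e)
      ((bsFixedPoints cs H ω).coeff e) = nilDWord cs H ω := by
  induction ω with
  | nil =>
    rw [nilDWord, List.map_nil, List.prod_nil, SkewMonoidAlgebra.one_def]
    exact Fintype.sum_unique (ι := Unit) _
  | cons s ω ih =>
    rw [nilDWord_cons, ← ih, nilD_eq, Finset.mul_sum]
    refine (Fintype.sum_sum_type (α₁ := (bsFixedPoints cs H ω).Idx)
      (α₂ := (bsFixedPoints cs H ω).Idx) _).trans ?_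
    rw [← Finset.sum_add_distrib]
    refine Finset.sum_congr rfl fun e _ => ?_
    rw [sub_mul, SkewMonoidAlgebra.single_mul_single, SkewMonoidAlgebra.single_mul_single, one_mul,
      one_smul, sub_eq_add_neg, ← SkewMonoidAlgebra.single_neg, ← neg_mul]
    rfl

variable (cs H) in
/-- The equivariant multiplicity `e_{x,ω}` is the sum of the coefficients of the subexpressions with
product `x`. -/
theorem equivMult_eq_sum [DecidableEq W] (x : W) (ω : List I) : equivMult cs H x ω =
    ∑ e with (bsFixedPoints cs H ω).elt e = x, (bsFixedPoints cs H ω).coeff e := by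
  rw [equivMult, ← sum_single_bsFixedPoints, Finset.sum_filter]
  have hsum : ∀ (T : Finset (bsFixedPoints cs H ω).Idx) (g : _ → SmashProduct cs H),
      (∑ e ∈ T, g e).coeff x = ∑ e ∈ T, (g e).coeff x := by
    classical
    intro T g
    induction T using Finset.induction_on with
    | empty => simp
    | insert a T ha ih => rw [Finset.sum_insert ha, Finset.sum_insert ha,
        SkewMonoidAlgebra.coeff_add, Finsupp.add_apply, ih]
  rw [hsum]
  exact Finset.sum_congr rfl fun e _ => SkewMonoidAlgebra.coeff_single_apply

end fixedPoints

/-! ### The lowest degrees -/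

section lowestDegree
universe u
variable {I W : Type*} {V : Type u} [Group W] {M : CoxeterMatrix I} [AddCommGroup V] [Module ℝ V]

theorem polyGr_neg {d : ℤ} (hd : d < 0) {f : PolyRing V} (hf : f ∈ polyGr V d) : f = 0 := by
  have : {f | ∃ l : List (Dual ℝ V), 2 * (l.length : ℤ) = d ∧
      f = (l.map (SymmetricAlgebra.ι ℝ (Dual ℝ V))).prod} = ∅ := by
    ext f
    simp only [Set.mem_ofPred_eq, Set.mem_empty_iff_false, iff_false, not_exists, not_and]
    intro l hl
    omega
  rw [polyGr, this, Submodule.span_empty] at hf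
  exact hf

theorem polyGr_zero {f : PolyRing V} (hf : f ∈ polyGr V 0) :
    ∃ r : ℝ, f = algebraMap ℝ (PolyRing V) r := by
  induction hf using Submodule.span_induction with
  | mem f hf =>
    obtain ⟨l, hl, rfl⟩ := hf
    have : l = [] := List.length_eq_zero_iff.1 (by omega)
    exact ⟨1, by simp [this]⟩
  | zero => exact ⟨0, by simp⟩
  | add f g _ _ hf hg =>
    obtain ⟨r, rfl⟩ := hf
    obtain ⟨t, rfl⟩ := hg
    exact ⟨r + t, by simp⟩
  | smul a f _ hf =>
    obtain ⟨r, rfl⟩ := hf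
    exact ⟨a * r, by rw [map_mul, Algebra.smul_def]⟩

variable (cs : CoxeterSystem M W) (H : Realisation M V)

theorem bsData_gr_eq_zero (ω : List I) {d : ℤ} (hd : d < -(ω.length : ℤ))
    {b : (bsData cs H ω).carrier} (hb : b ∈ (bsData cs H ω).gr d) : b = 0 := by
  induction ω generalizing d with
  | nil => exact polyGr_neg (by simpa using hd) hb
  | cons s ω ih =>
    rw [List.length_cons] at hd
    push_cast at hd
    have h1 := ih (by omega) (projSym_mem cs H s hb)
    have h2 := ih (by omega) (projAnti_mem cs H s hb)
    refine (eq_proj cs H s b).trans ?_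
    rw [h1, h2, tmk_zero, tmk_zero, add_zero]
    rfl

/-- The bottom degree of `B(ω)` is spanned by `1 ⊗ ⋯ ⊗ 1`. -/
theorem bsData_gr_bottom (ω : List I) {b : (bsData cs H ω).carrier}
    (hb : b ∈ (bsData cs H ω).gr (-(ω.length : ℤ))) :
    ∃ r : ℝ, b = (bsData cs H ω).left (algebraMap ℝ _ r) := by
  induction ω with
  | nil => exact polyGr_zero hb
  | cons s ω ih =>
    have h1 := projSym_mem cs H s hb
    have h2 := bsData_gr_eq_zero cs H ω (by rw [List.length_cons]; push_cast; omega)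
      (projAnti_mem cs H s hb)
    have e : -((s :: ω).length : ℤ) + 1 = -(ω.length : ℤ) := by
      rw [List.length_cons]; push_cast; omega
    rw [e] at h1
    obtain ⟨r, hr⟩ := ih h1
    refine ⟨r, (eq_proj cs H s b).trans ?_⟩
    rw [h2, hr, tmk_zero, add_zero, ← mul_one ((bsData cs H ω).left _),
      tmk_mul_left cs H s _ _ (AlgHom.commutes _ r), one_mul]
    rfl

end lowestDegree
/-! ### Local intersection forms -/

section localForm
universe u v
variable {I W : Type*} {V : Type u} [Group W] {M : CoxeterMatrix I} [AddCommGroup V] [Module ℝ V]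

/-- The homomorphism to `R` labelled by a subexpression, as a map of left `R`-modules. -/
noncomputable def FixedPoints.evLin {cs : CoxeterSystem M W} {H : Realisation M V} {C : BSData V}
    (L : FixedPoints cs H C) (e : L.Idx) : C.toGradedBimodule.carrier →ₗ[PolyRing V] PolyRing V where
  toFun b := L.ev e (show C.carrier from b)
  map_add' a b := map_add (L.ev e) _ _
  map_smul' f b := (map_mul (L.ev e) (C.left f) _).trans (by rw [L.ev_left]; rfl)

theorem FixedPoints.evLin_op_smul {cs : CoxeterSystem M W} {H : Realisation M V} {C : BSData V}
    (L : FixedPoints cs H C) (e : L.Idx) (f : PolyRing V) (b : C.toGradedBimodule.carrier) :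
    L.evLin e (MulOpposite.op f • b) = polyAct cs H (L.elt e) f * L.evLin e b :=
  (map_mul (L.ev e) (C.right f) _).trans (by rw [L.ev_right]; rfl)

theorem FixedPoints.form_eq {cs : CoxeterSystem M W} {H : Realisation M V} {C : BSData V}
    (L : FixedPoints cs H C) (b b' : C.toGradedBimodule.carrier) :
    algebraMap (PolyRing V) (RootLoc cs H) (C.form b b') =
      ∑ e, L.coeff e * algebraMap _ _ (L.evLin e b * L.evLin e b') := by
  refine (L.trace_eq ((show C.carrier from b) * (show C.carrier from b'))).trans ?_
  refine Finset.sum_congr rfl fun e _ => ?_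
  rw [map_mul]
  rfl

/-- An embedding of a bimodule `B` in a sum of copies of `R` with right action twisted by elements of
`W`, together with weights in `Q` that express a bilinear form on `B` in terms of this embedding. -/
structure TwistedEmbedding (cs : CoxeterSystem M W) (H : Realisation M V)
    (B : GradedBimodule.{u, v} V) (β : LinearMap.BilinForm (PolyRing V) B.carrier) where
  Idx : Type
  [fintype : Fintype Idx]
  elt : Idx → W
  coeff : Idx → RootLoc cs H
  φ : Idx → B.carrier →ₗ[PolyRing V] PolyRing V
  φ_op_smul : ∀ e f b, φ e (MulOpposite.op f • b) = polyAct cs H (elt e) f * φ e b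
  eq_zero : ∀ b, (∀ e, φ e b = 0) → b = 0
  form_eq : ∀ b b', algebraMap (PolyRing V) (RootLoc cs H) (β b b') =
    ∑ e, coeff e * algebraMap _ _ (φ e b * φ e b')

attribute [instance] TwistedEmbedding.fintype

variable (cs : CoxeterSystem M W) (H : Realisation M V)

/-- The localisation data of a Bott-Samelson bimodule, restricted to a submodule. -/
noncomputable def twistedEmbedding (ω : List I) {B : GradedBimodule.{u, v} V} {n : ℤ}
    (i : B.Hom (bottSamelson cs H ω) n) (hi : Function.Injective i.toLinearMap) :
    TwistedEmbedding cs H B ((intersectionForm cs H ω).comp i.toLinearMap i.toLinearMap) where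
  Idx := (bsFixedPoints cs H ω).Idx
  elt := (bsFixedPoints cs H ω).elt
  coeff := (bsFixedPoints cs H ω).coeff
  φ e := ((bsFixedPoints cs H ω).evLin e).comp i.toLinearMap
  φ_op_smul e f b := by
    refine (congrArg ((bsFixedPoints cs H ω).evLin e) (i.map_op_smul f b)).trans ?_
    exact (bsFixedPoints cs H ω).evLin_op_smul e f _
  eq_zero b h := by
    apply hi
    rw [map_zero]
    exact (bsFixedPoints cs H ω).eq_zero _ h
  form_eq b b' := (bsFixedPoints cs H ω).form_eq _ _

variable {cs H}
variable {B : GradedBimodule.{u, v} V} {β : LinearMap.BilinForm (PolyRing V) B.carrier}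
  (T : TwistedEmbedding cs H B β)

/-- A component with twist `x` factors through the stalk at `x`. -/
noncomputable def TwistedEmbedding.stalkMap {x : W} (e : T.Idx) (he : T.elt e = x) :
    Stalk cs H x B →ₗ[PolyRing V] PolyRing V :=
  (stalkRelations cs H x B).liftQ (T.φ e) (by
    rw [stalkRelations, Submodule.span_le]
    rintro _ ⟨r, b, rfl⟩
    rw [SetLike.mem_coe, LinearMap.mem_ker, map_sub, T.φ_op_smul, map_smul, he, smul_eq_mul,
      sub_self])

theorem TwistedEmbedding.stalkMap_toStalk {x : W} (e : T.Idx) (he : T.elt e = x) (b : B.carrier) :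
    T.stalkMap e he (toStalk cs H x B b) = T.φ e b :=
  Submodule.liftQ_apply _ _ _

open Classical in
/-- The local intersection form: the part of the sum for the form that belongs to twist `x`. -/
noncomputable def TwistedEmbedding.localForm (x : W) :
    Stalk cs H x B →ₗ[PolyRing V] Stalk cs H x B →ₗ[PolyRing V] RootLoc cs H :=
  ∑ e : {e : T.Idx // T.elt e = x},
    LinearMap.mk₂ (PolyRing V)
      (fun m m' => T.coeff e * algebraMap _ _ (T.stalkMap e.1 e.2 m * T.stalkMap e.1 e.2 m'))
      (fun a b c => by rw [map_add, add_mul, map_add, mul_add])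
      (fun f a b => by
        rw [map_smul, smul_eq_mul, mul_assoc, map_mul, Algebra.smul_def, mul_left_comm])
      (fun a b c => by rw [map_add, mul_add, map_add, mul_add])
      (fun f a b => by
        rw [map_smul, smul_eq_mul, mul_left_comm, map_mul, Algebra.smul_def, mul_left_comm])

theorem TwistedEmbedding.localForm_toStalk [DecidableEq W] (x : W) (b b' : B.carrier) :
    T.localForm x (toStalk cs H x B b) (toStalk cs H x B b') =
      ∑ e with T.elt e = x, T.coeff e * algebraMap _ _ (T.φ e b * T.φ e b') := by
  rw [localForm, LinearMap.sum_apply, LinearMap.sum_apply]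
  simp only [LinearMap.mk₂_apply, stalkMap_toStalk]
  rw [Finset.sum_subtype (p := fun e => T.elt e = x) _ (by simp)
    fun e => T.coeff e * algebraMap _ _ (T.φ e b * T.φ e b')]

/-- An element of the costalk at `x` has only components with twist `x`, since `W` acts faithfully
on linear forms. -/
theorem TwistedEmbedding.φ_eq_zero {x : W} {m : B.carrier} (hm : m ∈ costalk cs H x B) (e : T.Idx)
    (he : T.elt e ≠ x) : T.φ e m = 0 := by
  obtain ⟨f, hf⟩ := exists_polyAct_ne cs H he
  have h := congrArg (T.φ e) (hm (SymmetricAlgebra.ι ℝ _ f))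
  rw [T.φ_op_smul, map_smul, smul_eq_mul, ← sub_eq_zero, ← sub_mul, mul_eq_zero] at h
  exact h.resolve_left (sub_ne_zero.mpr hf)

theorem TwistedEmbedding.isLocalForm_localForm (x : W) :
    IsLocalForm cs H x B β (T.localForm x) := by
  classical
  intro m hm m' _
  rw [localForm_toStalk, T.form_eq]
  refine Finset.sum_subset (Finset.filter_subset _ _) fun e _ he => ?_
  rw [T.φ_eq_zero hm e (by simpa using he), zero_mul, map_zero, mul_zero]

/-- Up to a common non-zero factor from `R`, every element of the stalk comes from the costalk. The
operators `b ↦ b · g - w(g) · b` with `w ≠ x` and `w(g) ≠ x(g)` kill the components with twist `w`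
and act on the stalk at `x` by the non-zero scalar `x(g) - w(g)`. -/
theorem TwistedEmbedding.exists_smul_mem_costalk (T : TwistedEmbedding cs H B β) (x : W) : ∃ r : PolyRing V, r ≠ 0 ∧
    ∀ b : B.carrier, ∃ m ∈ costalk cs H x B, toStalk cs H x B m = r • toStalk cs H x B b := by
  classical
  have key : ∀ S : Finset T.Idx, (∀ e ∈ S, T.elt e ≠ x) → ∃ r : PolyRing V, r ≠ 0 ∧
      ∀ b : B.carrier, ∃ m : B.carrier, (∀ e ∈ S, T.φ e m = 0) ∧
        toStalk cs H x B m = r • toStalk cs H x B b := by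
    intro S
    induction S using Finset.induction_on with
    | empty => exact fun _ => ⟨1, one_ne_zero, fun b => ⟨b, by simp, (one_smul _ _).symm⟩⟩
    | insert e S he ih =>
      intro hS
      obtain ⟨r, hr, hrb⟩ := ih fun e' he' => hS e' (Finset.mem_insert_of_mem he')
      obtain ⟨g, hg⟩ := exists_polyAct_ne cs H (hS e (Finset.mem_insert_self e S)).symm
      set g := SymmetricAlgebra.ι ℝ (Dual ℝ V) g
      refine ⟨(polyAct cs H x g - polyAct cs H (T.elt e) g) * r,
        mul_ne_zero (sub_ne_zero.mpr hg) hr, fun b => ?_⟩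
      obtain ⟨m, hm, hmb⟩ := hrb b
      have hφ : ∀ e', T.φ e' (MulOpposite.op g • m - polyAct cs H (T.elt e) g • m) =
          (polyAct cs H (T.elt e') g - polyAct cs H (T.elt e) g) * T.φ e' m := by
        intro e'
        rw [map_sub, T.φ_op_smul, map_smul, smul_eq_mul, sub_mul]
      refine ⟨MulOpposite.op g • m - polyAct cs H (T.elt e) g • m, fun e' he' => ?_, ?_⟩
      · rw [hφ]
        rcases Finset.mem_insert.1 he' with rfl | he'
        · rw [sub_self, zero_mul]
        · rw [hm e' he', mul_zero]
      · have hrel : toStalk cs H x B (MulOpposite.op g • m) =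
            polyAct cs H x g • toStalk cs H x B m := by
          rw [← map_smul, ← sub_eq_zero, ← map_sub]
          exact (Submodule.Quotient.mk_eq_zero _).2 (Submodule.subset_span ⟨g, m, rfl⟩)
        rw [map_sub, hrel, map_smul, ← sub_smul, hmb, smul_smul]
  obtain ⟨r, hr, hrb⟩ := key {e | T.elt e ≠ x} (by simp)
  refine ⟨r, hr, fun b => ?_⟩
  obtain ⟨m, hm, hmb⟩ := hrb b
  refine ⟨m, fun f => ?_, hmb⟩
  rw [← sub_eq_zero]
  refine T.eq_zero _ fun e => ?_
  rw [map_sub, T.φ_op_smul, map_smul, smul_eq_mul, ← sub_mul]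
  by_cases he : T.elt e = x
  · rw [he, sub_self, zero_mul]
  · rw [hm e (by simpa using he), mul_zero]

theorem TwistedEmbedding.eq_localForm {x : W}
    {F : Stalk cs H x B →ₗ[PolyRing V] Stalk cs H x B →ₗ[PolyRing V] RootLoc cs H}
    (hF : IsLocalForm cs H x B β F) : F = T.localForm x := by
  obtain ⟨r, hr, hrb⟩ := T.exists_smul_mem_costalk x
  have hrQ : algebraMap (PolyRing V) (RootLoc cs H) r ≠ 0 :=
    (map_ne_zero_iff _ (algebraMap_rootLoc_injective cs H)).2 hr
  refine LinearMap.ext fun m => LinearMap.ext fun m' => ?_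
  obtain ⟨b, rfl⟩ := Submodule.mkQ_surjective _ m
  obtain ⟨b', rfl⟩ := Submodule.mkQ_surjective _ m'
  change F (toStalk cs H x B b) (toStalk cs H x B b') =
    T.localForm x (toStalk cs H x B b) (toStalk cs H x B b')
  obtain ⟨n, hn, hnb⟩ := hrb b
  obtain ⟨n', hn', hnb'⟩ := hrb b'
  have h := (hF n hn n' hn').trans (T.isLocalForm_localForm x n hn n' hn').symm
  rw [hnb, hnb'] at h
  simp only [map_smul, LinearMap.smul_apply, Algebra.smul_def] at h
  exact mul_left_cancel₀ hrQ (mul_left_cancel₀ hrQ h)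

end localForm
end Soergel

theorem theorem1p3 {I : Type*} {W : Type*} [Group W] {M : CoxeterMatrix I}
    (cs : CoxeterSystem M W)
    {V : Type*} [AddCommGroup V] [Module ℝ V] [FiniteDimensional ℝ V]
    (H : Soergel.Realisation M V) (hH : H.IsMinimal)
    (x y : W)
    -- the bimodule `B = B(y)`
    (B : Soergel.GradedBimodule V) (hB : Soergel.IsIndecomposableSoergel cs H y B)
    -- `B` is realised as a summand of `B(ω)` for a reduced word `ω` of `y`
    (ω : List I) (hω : cs.IsReduced ω) (hωy : cs.wordProd ω = y)
    (i : B.Hom (Soergel.bottSamelson cs H ω) 0) (p : (Soergel.bottSamelson cs H ω).Hom B 0)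
    (hpi : ∀ b, p.toLinearMap (i.toLinearMap b) = b)
    -- a generator of the lowest degree piece of `B(y)`
    (c₀ : B.carrier) (hc₀ : c₀ ∈ B.gr (-(cs.length y : ℤ))) (hc₀_ne : c₀ ≠ 0)
    -- a reduced word of `y`, which computes `D_y`
    (η : List I) (hη : cs.IsReduced η) (hηy : cs.wordProd η = y) :
    (∀ d : ℤ, d < -(cs.length y : ℤ) → Soergel.stalkGr cs H x B d = ⊥) ∧
    Soergel.Generates V (Soergel.toStalk cs H x B c₀)
      (Soergel.stalkGr cs H x B (-(cs.length y : ℤ))) ∧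
    (∃! F : Soergel.Stalk cs H x B →ₗ[Soergel.PolyRing V]
        Soergel.Stalk cs H x B →ₗ[Soergel.PolyRing V] Soergel.RootLoc cs H,
      Soergel.IsLocalForm cs H x B
        ((Soergel.intersectionForm cs H ω).comp i.toLinearMap i.toLinearMap) F) ∧
    ∀ F : Soergel.Stalk cs H x B →ₗ[Soergel.PolyRing V]
        Soergel.Stalk cs H x B →ₗ[Soergel.PolyRing V] Soergel.RootLoc cs H,
      Soergel.IsLocalForm cs H x B
        ((Soergel.intersectionForm cs H ω).comp i.toLinearMap i.toLinearMap) F →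
      ∀ c : Soergel.Stalk cs H x B,
        Soergel.Generates V c (Soergel.stalkGr cs H x B (-(cs.length y : ℤ))) →
        ∃ γ : ℝ, 0 < γ ∧ F c c = γ • Soergel.equivMult cs H x η := by
  classical
  have hlen : cs.length y = ω.length := by rw [← hωy]; exact hω
  rw [hlen] at hc₀ ⊢
  have hi : Function.Injective i.toLinearMap := Function.LeftInverse.injective hpi
  have hgr : ∀ d : ℤ, ∀ b ∈ B.gr d, i.toLinearMap b ∈ (Soergel.bsData cs H ω).gr d := by
    intro d b hb
    have h := i.map_gr d b hb
    rwa [add_zero] at h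
  let T := Soergel.twistedEmbedding cs H ω i hi
  -- The bottom degree of `B` embeds in that of `B(ω)`, which consists of real multiples of `1`.
  have hbot : ∀ b ∈ B.gr (-(ω.length : ℤ)), ∃ r : ℝ, i.toLinearMap b =
      (Soergel.bsData cs H ω).left (algebraMap ℝ _ r) :=
    fun b hb => Soergel.bsData_gr_bottom cs H ω (hgr _ b hb)
  obtain ⟨a, ha⟩ := hbot c₀ hc₀
  have ha0 : a ≠ 0 := by
    rintro rfl
    apply hc₀_ne
    apply hi
    rw [ha, map_zero, map_zero, map_zero]
    rfl
  have hspan : ∀ b ∈ B.gr (-(ω.length : ℤ)),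
      ∃ r : ℝ, b = algebraMap ℝ (Soergel.PolyRing V) r • c₀ := by
    intro b hb
    obtain ⟨r, hr⟩ := hbot b hb
    refine ⟨r / a, hi ?_⟩
    rw [map_smul, hr, ha]
    change _ = (Soergel.bsData cs H ω).left _ * (Soergel.bsData cs H ω).left _
    rw [← map_mul, ← map_mul, div_mul_cancel₀ _ ha0]
  have hmem : Soergel.toStalk cs H x B c₀ ∈ Soergel.stalkGr cs H x B (-(ω.length : ℤ)) :=
    ⟨c₀, hc₀, rfl⟩
  -- All the homomorphisms to `R` take the value `a` on `c₀`, so the form is `a²` times the sum of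
  -- the coefficients of the subexpressions with product `x`.
  have hval : T.localForm x (Soergel.toStalk cs H x B c₀) (Soergel.toStalk cs H x B c₀) =
      (a * a) • Soergel.equivMult cs H x η := by
    have hφ : ∀ e, T.φ e c₀ = algebraMap ℝ _ a := by
      intro e
      refine Eq.trans ?_ ((Soergel.bsFixedPoints cs H ω).ev_left e (algebraMap ℝ _ a))
      exact congrArg ((Soergel.bsFixedPoints cs H ω).ev e) ha
    rw [T.localForm_toStalk, ← Soergel.equivMult_eq cs H hω hη (hωy.trans hηy.symm) x,
      Soergel.equivMult_eq_sum, Algebra.smul_def, Finset.mul_sum]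
    refine Finset.sum_congr rfl fun e _ => ?_
    rw [hφ, ← map_mul, mul_comm]
    rfl
  refine ⟨fun d hd => ?_, ⟨hmem, ?_⟩, ?_, ?_⟩
  · rw [eq_bot_iff]
    rintro _ ⟨b, hb, rfl⟩
    have hb0 : b = 0 := by
      apply hi
      rw [map_zero]
      exact Soergel.bsData_gr_eq_zero cs H ω hd (hgr d b hb)
    rw [hb0, map_zero]
    exact AddSubgroup.zero_mem _
  · rintro _ ⟨b, hb, rfl⟩
    obtain ⟨r, rfl⟩ := hspan b hb
    exact ⟨r, (Soergel.toStalk cs H x B).map_smul _ _⟩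
  · exact ⟨T.localForm x, T.isLocalForm_localForm x, fun F hF => T.eq_localForm hF⟩
  · rintro F hF c ⟨hc, hc'⟩
    rw [T.eq_localForm hF]
    obtain ⟨b, hb, rfl⟩ := hc
    obtain ⟨r, rfl⟩ := hspan b hb
    by_cases hr : Soergel.toStalk cs H x B c₀ = 0
    · -- If the stalk vanishes in the bottom degree, then so does `e_{x,y}`.
      refine ⟨a * a, mul_self_pos.2 ha0, ?_⟩
      rw [← hval, hr]
      change T.localForm x (Soergel.toStalk cs H x B (algebraMap ℝ (Soergel.PolyRing V) r • c₀))
        (Soergel.toStalk cs H x B (algebraMap ℝ (Soergel.PolyRing V) r • c₀)) = _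
      rw [map_smul, hr, smul_zero, map_zero]
    · have hr0 : r ≠ 0 := by
        rintro rfl
        obtain ⟨t, ht⟩ := hc' _ hmem
        apply hr
        rw [ht]
        change algebraMap ℝ (Soergel.PolyRing V) t • Soergel.toStalk cs H x B _ = 0
        rw [map_zero, zero_smul, map_zero, smul_zero]
      refine ⟨r * r * (a * a), mul_pos (mul_self_pos.2 hr0) (mul_self_pos.2 ha0), ?_⟩
      change T.localForm x (Soergel.toStalk cs H x B (algebraMap ℝ (Soergel.PolyRing V) r • c₀))
        (Soergel.toStalk cs H x B (algebraMap ℝ (Soergel.PolyRing V) r • c₀)) = _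
      rw [map_smul, map_smul, map_smul, LinearMap.smul_apply, hval,
        mul_smul (r * r), mul_smul r r]
      rfl
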